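/- Write permutations of $\{1,\dots,n\}$ as words $\sigma=\sigma_1\cdots\sigma_n$. Let $\mathrm{des}(\sigma)$ be the number of $i$ with $\sigma_i>\sigma_{i+1}$, and let $\mathrm{LRmin}(\sigma)$ be the number of $j$ such that $\sigma_j<\sigma_i$ for all $i<j$. The reduction of a word of $p$ distinct integers is the permutation of $\{1,\dots,p\}$ obtained by replacing its $i$-th smallest entry by $i$. For a set $\Gamma$ of permutations, let $\mathcal{NM}_n(\Gamma)$ be the set of permutations $\sigma$ of $\{1,\dots,n\}$ such that no word $\sigma_i\sigma_{i+1}\cdots\sigma_{i+j}$ with $j\ge1$ has its reduction in $\Gamma$, and let $$\mathrm{NM}_\Gamma(t,x,y)=1+\sum_{n\ge1}\frac{t^n}{n!}\sum_{\sigma\in\mathcal{NM}_n(\Gamma)}x^{\mathrm{LRmin}(\sigma)}y^{1+\mathrm{des}(\sigma)},$$ a formal power series in $t$ with coefficients in $\mathbb{Q}[x,y]$. For a power series $A$ in $t$ with constant term $1$, let $A^x=\sum_{k\ge0}\binom{x}{k}(A-1)^k$. **Theorem.** Let $k_1,k_2\ge2$, $m=\min(k_1,k_2)$, $M=\max(k_1,k_2)$,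 and let $\Gamma=\Gamma_{k_1,k_2}$ be the set of permutations $\sigma$ of $\{1,\dots,k_1+k_2\}$ with $\sigma_1=1$, $\sigma_{k_1+1}=2$, $\sigma_1<\sigma_2<\cdots<\sigma_{k_1}$ and $\sigma_{k_1+1}<\sigma_{k_1+2}<\cdots<\sigma_{k_1+k_2}$. Then there are polynomials $U_{\Gamma,n}(y)\in\mathbb{Z}[y]$, $n\ge1$, such that $$\mathrm{NM}_\Gamma(t,x,y)=\left(\frac{1}{U_\Gamma(t,y)}\right)^x,\qquad U_\Gamma(t,y)=1+\sum_{n\ge1}U_{\Gamma,n}(y)\frac{t^n}{n!},$$ and such that, with $U_{\Gamma,0}(y)=1$ and $U_{\Gamma,n}(y)=0$ for $n<0$, we have $U_{\Gamma,1}(y)=-y$ and, for every $n\ge2$, except for $n=k_2$ in the case $k_1<k_2$, $$U_{\Gamma,n}(y)=(1-y)U_{\Gamma,n-1}(y)-y\binom{n-2}{k_1-1}\left(U_{\Gamma,n-M}(y)+y\sum_{i=1}^{m-1}U_{\Gamma,n-M-i}(y)\right),$$ while $U_{\Gamma,k_2}(y)=(1-y)U_{\Gamma,k_2-1}(y)$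 if $k_1<k_2$. -/

import Mathlib

open scoped Nat

noncomputable section

/-! Permutations of `{1, …, n}` are written with `0`-based positions and values, as elements of
`Equiv.Perm (Fin n)`; the word of `σ` is `σ 0, σ 1, …, σ (n - 1)`.  A set `Γ` of permutations (of
possibly different lengths) is given by its sets `Γ p` of members of length `p`. -/

/-- The reduction of a word `w` of `p` distinct integers: every entry is replaced by its rank
(starting with rank `0` for the smallest entry). -/
def reduction {p : ℕ} (w : Fin p → ℕ) (a : Fin p) : ℕ :=
  (Finset.univ.filter fun b => w b < w a).card

/-- `σ` has a `Γ`-match starting at position `i`: for some `j ≥ 1` the word `σ i, …, σ (i + j)`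
lies inside `σ` and its reduction is a member of `Γ`. -/
def HasMatchAt (Γ : (p : ℕ) → Set (Equiv.Perm (Fin p))) {n : ℕ} (σ : Equiv.Perm (Fin n))
    (i : ℕ) : Prop :=
  ∃ j : ℕ, 1 ≤ j ∧ ∃ h : i + j < n, ∃ τ ∈ Γ (j + 1), ∀ a : Fin (j + 1),
    reduction (fun b : Fin (j + 1) => (σ ⟨i + b, by omega⟩ : ℕ)) a = (τ a : ℕ)

/-- The permutations of length `n` without any `Γ`-match. -/
def noMatch (Γ : (p : ℕ) → Set (Equiv.Perm (Fin p))) (n : ℕ) : Finset (Equiv.Perm (Fin n)) :=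
  open Classical in Finset.univ.filter fun σ => ∀ i : ℕ, ¬ HasMatchAt Γ σ i

/-- The number of descents. -/
def des {n : ℕ} (σ : Equiv.Perm (Fin n)) : ℕ :=
  open Classical in
  (Finset.univ.filter fun i : Fin n => ∃ h : (i : ℕ) + 1 < n, σ ⟨i + 1, h⟩ < σ i).card

/-- The number of left-to-right minima. -/
def lrmin {n : ℕ} (σ : Equiv.Perm (Fin n)) : ℕ :=
  open Classical in
  (Finset.univ.filter fun j : Fin n => ∀ i : Fin n, i < j → σ j < σ i).card

/-- The coefficient ring `ℚ[y][x]`. -/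
abbrev QYX : Type := Polynomial (Polynomial ℚ)

/-- The variable `x` of `ℚ[y][x]`. -/
def varX : QYX := Polynomial.X

/-- The variable `y` of `ℚ[y][x]`. -/
def varY : QYX := Polynomial.C Polynomial.X

/-- An integer polynomial in `y`, as an element of `ℚ[y][x]`. -/
def inY (p : Polynomial ℤ) : QYX := Polynomial.C (p.map (Int.castRingHom ℚ))

/-- The exponential generating function `∑ₙ a n * t ^ n / n!`. -/
def expGen (a : ℕ → QYX) : PowerSeries QYX :=
  PowerSeries.mk fun n => ((n ! : ℚ)⁻¹) • a n

/-- The polynomial `∑ x ^ lrmin σ * y ^ (1 + des σ)` over the permutations `σ` of length `n`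
without `Γ`-matches; the value for `n = 0` is `1`. -/
def nmPoly (Γ : (p : ℕ) → Set (Equiv.Perm (Fin p))) (n : ℕ) : QYX :=
  if n = 0 then 1 else ∑ σ ∈ noMatch Γ n, varX ^ lrmin σ * varY ^ (1 + des σ)

/-- The generating function `NM_Γ(t, x, y)`, a power series in `t`. -/
def NM (Γ : (p : ℕ) → Set (Equiv.Perm (Fin p))) : PowerSeries QYX := expGen (nmPoly Γ)

/-- The reciprocal `1 / A` of a power series `A` with constant term `1`. -/
def recip (A : PowerSeries QYX) : PowerSeries QYX := PowerSeries.invOfUnit A 1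

/-- The power `A ^ r = ∑ₖ (r choose k) (A - 1) ^ k` of a power series `A` with constant
term `1`, for an arbitrary exponent `r` in the coefficient ring. -/
def formalPow (A : PowerSeries QYX) (r : QYX) : PowerSeries QYX :=
  (PowerSeries.binomialSeries QYX r).subst (A - 1)

/-- The family `Γ_{k₁,k₂}`: the permutations of length `k₁ + k₂` whose first entry is the
smallest one, whose entry in (`1`-based) position `k₁ + 1` is the second smallest one, and whose
first `k₁` entries and last `k₂` entries are both increasing. -/
def gammaFamily (k₁ k₂ : ℕ) (p : ℕ) : Set (Equiv.Perm (Fin p)) :=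
  {τ | p = k₁ + k₂ ∧
    (∀ a : Fin p, (a : ℕ) = 0 → (τ a : ℕ) = 0) ∧
    (∀ a : Fin p, (a : ℕ) = k₁ → (τ a : ℕ) = 1) ∧
    (∀ a b : Fin p, a < b → (b : ℕ) < k₁ → τ a < τ b) ∧
    (∀ a b : Fin p, k₁ ≤ (a : ℕ) → a < b → τ a < τ b)}

/-- `U_{n-j}`, where `U` is extended by `0` to negative indices. -/
def back (U : ℕ → Polynomial ℤ) (n j : ℕ) : Polynomial ℤ := if j ≤ n then U (n - j) else 0

end

/-! Two facts carry the proof, both about sums over all arrangements of a set.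

The exponent `x`: an occurrence of the family starts with its smallest entry, so no occurrence
straddles the minimum of a word. Cutting a word at its minimum multiplies the weights
(`avoidWt_split`), and summing gives NM' = x·c·NM, where c enumerates the avoiding words that start
with their minimum and does not involve `x` (`wordSum_avoidWt_succ`). The power A^x of the series A
at `x = 1` satisfies the same equation with the same constant term, so NM = A^x.

The series `U`: the inverse of A is found already on words. `clusterWt` is a weight whose
convolution with the avoidance weight over all cuts of a nonempty word vanishes
(`sum_clusterWt_mul_avoidWt`); summing over arrangements turns cuts into binomial convolutions, so
the exponential generating function of the sums of `clusterWt` is 1/A. Two overlapping occurrences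
are at least `max k₁ k₂` apart, so a second one starts in the second run of the first. This makes
the recursive definition of `clusterWt` short.

The recursion for U_n is the recursion of `clusterWt` summed over arrangements. A word of nonzero
cluster weight starts with its minimum. In an initial occurrence the two smallest entries are
therefore placed, and what remains is to choose the other `k₁ - 1` entries of the first run among `n
- 2` (`sum_listOcc`). For `n < k₁ + k₂` there are no occurrences, and the extra term of the stated
recursion vanishes outside the exceptional case (`clusterPolynomial_recursion`). -/

/-! ### Occurrences and cluster weights of words -/

/-- The word `w s, …, w (e - 1)` starts with an occurrence of the family `Γ_{k₁,k₂}`. -/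
def Occ (k₁ k₂ : ℕ) (w : ℕ → ℕ) (s e : ℕ) : Prop :=
  s + (k₁ + k₂) ≤ e ∧ (∀ i, i + 1 < k₁ → w (s + i) < w (s + i + 1)) ∧
    (∀ i, k₁ ≤ i → i + 1 < k₁ + k₂ → w (s + i) < w (s + i + 1)) ∧
    w s < w (s + k₁) ∧ w (s + k₁) < w (s + 1)

/-- The signed cluster weight of the word `w s, …, w (e - 1)`: the inverse, under deconcatenation,
of the weight `y ^ (1 + des)` restricted to words without occurrences. -/
noncomputable def clusterWt {R : Type*} [CommRing R] (k₁ k₂ : ℕ) (y : R) (w : ℕ → ℕ)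
    (s e : ℕ) : R :=
  open Classical in
  if e ≤ s then 1
  else if e = s + 1 then -y
  else if Occ k₁ k₂ w s e then
    -- The form `- 1 … + 1` makes every shift positive even for `k₁ = k₂ = 0`, so that the recursion
    -- terminates without hypotheses.
    -y * (clusterWt k₁ k₂ y w (s + (max k₁ k₂ - 1) + 1) e +
      y * ∑ i ∈ Finset.Icc 1 (min k₁ k₂ - 1), clusterWt k₁ k₂ y w (s + (max k₁ k₂ - 1 + i) + 1) e)
  else if w s < w (s + 1) then (1 - y) * clusterWt k₁ k₂ y w (s + 1) e
  else 0
termination_by e - s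

/-- The number of non-ascents of the word `w s, …, w (e - 1)`. -/
def descents (w : ℕ → ℕ) (s e : ℕ) : ℕ :=
  ((Finset.Ico s (e - 1)).filter fun i => ¬ w i < w (i + 1)).card

/-- The number of left-to-right minima of the word `w s, …, w (e - 1)`. -/
noncomputable def leftMinima (w : ℕ → ℕ) (s e : ℕ) : ℕ :=
  open Classical in
  ((Finset.Ico s e).filter fun j => ∀ i, s ≤ i → i < j → w j < w i).card

/-- The word `w s, …, w (e - 1)` has no occurrence of the family `Γ_{k₁,k₂}`. -/
def Avoids (k₁ k₂ : ℕ) (w : ℕ → ℕ) (s e : ℕ) : Prop := ∀ i, s ≤ i → ¬ Occ k₁ k₂ w i e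

/-- The weight `x ^ lrmin * y ^ (1 + des)` of a nonempty avoiding word. -/
noncomputable def avoidWt {R : Type*} [CommRing R] (k₁ k₂ : ℕ) (x y : R) (w : ℕ → ℕ)
    (s e : ℕ) : R :=
  open Classical in
  if e ≤ s then 1
  else if Avoids k₁ k₂ w s e then x ^ leftMinima w s e * y ^ (1 + descents w s e)
  else 0

section Words

variable {R : Type*} [CommRing R] {k₁ k₂ : ℕ} {w : ℕ → ℕ} {s e : ℕ} {x y : R}

theorem lt_of_ascending {a b : ℕ} (h : ∀ i, a ≤ i → i + 1 < b → w i < w (i + 1)) {i j : ℕ}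
    (hi : a ≤ i) (hij : i < j) (hj : j < b) : w i < w j := by
  induction j, hij using Nat.le_induction with
  | base => exact h i hi hj
  | succ j hij ih => exact (ih (by omega)).trans (h j (by omega) hj)

theorem Occ.left_lt (h : Occ k₁ k₂ w s e) {i j : ℕ} (hij : i < j) (hj : j < k₁) :
    w (s + i) < w (s + j) :=
  lt_of_ascending (w := fun i => w (s + i)) (a := 0) (b := k₁) (fun i _ hi => h.2.1 i hi)
    (Nat.zero_le i) hij hj

theorem Occ.right_lt (h : Occ k₁ k₂ w s e) {i j : ℕ} (hi : k₁ ≤ i) (hij : i < j)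
    (hj : j < k₁ + k₂) : w (s + i) < w (s + j) :=
  lt_of_ascending (w := fun i => w (s + i)) (a := k₁) (b := k₁ + k₂)
    (fun i h1 hi => h.2.2.1 i h1 hi) hi hij hj

theorem Occ.second_le (h : Occ k₁ k₂ w s e) {j : ℕ} (h1 : 1 ≤ j) (hj : j < k₁) :
    w (s + 1) ≤ w (s + j) := by
  rcases h1.eq_or_lt with rfl | h1
  · rfl
  · exact (h.left_lt h1 hj).le

theorem Occ.descent (hk₁ : 2 ≤ k₁) (h : Occ k₁ k₂ w s e) :
    w (s + k₁) < w (s + (k₁ - 1)) :=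
  h.2.2.2.2.trans_le (h.second_le (by omega) (by omega))

theorem Occ.head_lt (h : Occ k₁ k₂ w s e) {j : ℕ} (h0 : 0 < j) (hj : j < k₁ + k₂) :
    w s < w (s + j) := by
  rcases lt_or_ge j k₁ with h1 | h1
  · exact h.left_lt (i := 0) h0 h1
  · rcases h1.eq_or_lt with rfl | h1
    · exact h.2.2.2.1
    · exact h.2.2.2.1.trans (h.right_lt le_rfl h1 hj)

/-- The only descent of an occurrence lies between its two runs. For a shift `t < k₁` the descent of
the first occurrence would fall into the first run of the second; for `t < k₂` the descent of the
second would fall into the second run of the first. -/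
theorem Occ.not_occ_of_lt (hk₁ : 2 ≤ k₁) (h : Occ k₁ k₂ w s e) {t : ℕ} (h1 : 1 ≤ t)
    (ht : t < max k₁ k₂) : ¬ Occ k₁ k₂ w (s + t) e := by
  intro h'
  rcases lt_max_iff.1 ht with ht | ht
  · have h2 := h'.2.1 (k₁ - 1 - t) (by omega)
    have h3 := h.descent hk₁
    rw [show s + t + (k₁ - 1 - t) = s + (k₁ - 1) by omega,
      show s + (k₁ - 1) + 1 = s + k₁ by omega] at h2
    omega
  · have h2 := h.2.2.1 (t + k₁ - 1) (by omega) (by omega)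
    have h3 := h'.descent hk₁
    rw [show s + (t + k₁ - 1) = s + t + (k₁ - 1) by omega,
      show s + t + (k₁ - 1) + 1 = s + t + k₁ by omega] at h2
    omega

theorem clusterWt_nil (h : e ≤ s) : clusterWt k₁ k₂ y w s e = 1 := by
  rw [clusterWt, if_pos h]

theorem clusterWt_single : clusterWt k₁ k₂ y w s (s + 1) = -y := by
  rw [clusterWt, if_neg (by omega), if_pos rfl]

theorem clusterWt_occ (hk₁ : 2 ≤ k₁) (h : Occ k₁ k₂ w s e) :
    clusterWt k₁ k₂ y w s e = -y * (clusterWt k₁ k₂ y w (s + max k₁ k₂) e +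
      y * ∑ i ∈ Finset.Icc 1 (min k₁ k₂ - 1), clusterWt k₁ k₂ y w (s + (max k₁ k₂ + i)) e) := by
  have := h.1
  have hM : k₁ ≤ max k₁ k₂ := le_max_left _ _
  rw [clusterWt, if_neg (by omega), if_neg (by omega), if_pos h,
    show s + (max k₁ k₂ - 1) + 1 = s + max k₁ k₂ by omega]
  congr 3
  refine Finset.sum_congr rfl fun i _ => ?_
  rw [show s + (max k₁ k₂ - 1 + i) + 1 = s + (max k₁ k₂ + i) by omega]

theorem clusterWt_not_occ (hs : s + 2 ≤ e) (h : ¬ Occ k₁ k₂ w s e) :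
    clusterWt k₁ k₂ y w s e = if w s < w (s + 1) then (1 - y) * clusterWt k₁ k₂ y w (s + 1) e
      else 0 := by
  rw [clusterWt, if_neg (by omega), if_neg (by omega), if_neg h]

/-- Every recursive step passes to a suffix whose first entry is larger: either the next entry after
an ascent, or an entry of an occurrence starting at `s`. Induction on the length then covers the
rest of the word. -/
theorem head_lt_of_clusterWt_ne_zero (hk₁ : 2 ≤ k₁) (hk₂ : 2 ≤ k₂) :
    ∀ {s : ℕ}, clusterWt k₁ k₂ y w s e ≠ 0 → ∀ i, s < i → i < e → w s < w i := by
  suffices H : ∀ n s, e - s = n → clusterWt k₁ k₂ y w s e ≠ 0 → ∀ i, s < i → i < e → w s < w i from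
    fun {s} => H (e - s) s rfl
  intro n
  induction n using Nat.strong_induction_on with
  | _ n ih =>
  intro s hn h i hi hie
  by_cases ho : Occ k₁ k₂ w s e
  · have hM := le_max_left k₁ k₂
    have hW : max k₁ k₂ + min k₁ k₂ = k₁ + k₂ := by omega
    have key : ∀ t, max k₁ k₂ ≤ t → t < k₁ + k₂ → clusterWt k₁ k₂ y w (s + t) e ≠ 0 →
        w s < w i := by
      intro t ht1 ht2 ht
      rcases lt_or_ge i (s + (k₁ + k₂)) with h1 | h1
      · have := ho.head_lt (j := i - s) (by omega) (by omega)
        rwa [show s + (i - s) = i by omega] at this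
      · exact (ho.head_lt (by omega) ht2).trans
          (ih (e - (s + t)) (by omega) (s + t) rfl ht i (by omega) hie)
    rw [clusterWt_occ hk₁ ho] at h
    -- If every suffix in the recursion had weight zero, so would the word; hence one suffix
    -- starting inside the occurrence has nonzero weight, and `key` applies to it.
    by_contra hcon
    refine h ?_
    have h0 : ∀ t, max k₁ k₂ ≤ t → t < k₁ + k₂ → clusterWt k₁ k₂ y w (s + t) e = 0 := by
      intro t ht1 ht2
      by_contra hne
      exact hcon (key t ht1 ht2 hne)
    rw [h0 _ le_rfl (by omega),
      Finset.sum_eq_zero]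
    · simp
    · intro j hj
      rw [Finset.mem_Icc] at hj
      exact h0 _ (by omega) (by omega)
  · rw [clusterWt_not_occ (by omega) ho] at h
    split_ifs at h with hlt
    · rcases (show s + 1 ≤ i from hi).eq_or_lt with rfl | hi'
      · exact hlt
      · exact hlt.trans (ih (e - (s + 1)) (by omega) (s + 1) rfl (right_ne_zero_of_mul h) i hi' hie)
    · exact absurd rfl h

/-- A descent is tolerated only inside an occurrence, after a first run of `k₁` entries, so the
first `k₁ - 1` steps are ascents. -/
theorem ascending_of_clusterWt_ne_zero {s : ℕ} (h : clusterWt k₁ k₂ y w s e ≠ 0)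
    {i : ℕ} (hi : i + 1 < k₁) (hie : s + i + 1 < e) : w (s + i) < w (s + i + 1) := by
  induction i generalizing s with
  | zero =>
    by_cases ho : Occ k₁ k₂ w s e
    · exact ho.2.1 0 hi
    · rw [clusterWt_not_occ (by omega) ho] at h
      by_contra hlt
      exact h (if_neg hlt)
  | succ i ih =>
    by_cases ho : Occ k₁ k₂ w s e
    · exact ho.2.1 (i + 1) hi
    · rw [clusterWt_not_occ (by omega) ho] at h
      split_ifs at h with hlt
      · have := ih (right_ne_zero_of_mul h) (by omega) (by omega)
        rwa [show s + 1 + i = s + (i + 1) by omega] at this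
      · exact absurd rfl h

end Words

/-! ### The deconcatenation identity -/

/-- The cluster weight of an increasing word of length `j`. -/
def ascendingWt {R : Type*} [CommRing R] (y : R) (j : ℕ) : R :=
  if j = 0 then 1 else -y * (1 - y) ^ (j - 1)

section WordIdentity

variable {R : Type*} [CommRing R] {k₁ k₂ : ℕ} {w : ℕ → ℕ} {s e : ℕ} {x y : R}

theorem ascendingWt_succ_succ (y : R) (j : ℕ) :
    ascendingWt y (j + 2) = (1 - y) * ascendingWt y (j + 1) := by
  simp only [ascendingWt, Nat.add_eq_zero_iff, OfNat.ofNat_ne_zero, one_ne_zero, and_false,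
    if_false, Nat.add_sub_cancel, show j + 2 - 1 = j + 1 by omega]
  ring

/-- The partial sums of `ascendingWt y` up to `j` telescope to `(1 - y) ^ j`. The identity serves
twice: in the convolution over an occurrence, and for the vanishing of the extra term of the
recursion at small `n`. -/
theorem ascendingWt_add_sum (y : R) (j : ℕ) :
    ascendingWt y (j + 1) + y * ∑ i ∈ Finset.Icc 1 (j + 1), ascendingWt y (j + 1 - i) = 0 := by
  have h : ∀ j, ∑ i ∈ Finset.Icc 1 (j + 1), ascendingWt y (j + 1 - i) =
      ∑ i ∈ Finset.range (j + 1), ascendingWt y i := by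
    intro j
    rw [← Finset.sum_range_reflect]
    refine Finset.sum_bij' (fun i _ => i - 1) (fun i _ => i + 1) ?_ ?_ ?_ ?_ ?_ <;>
      simp only [Finset.mem_Icc, Finset.mem_range]
    · omega
    · omega
    · omega
    · omega
    · intro i hi
      congr 1
      omega
  rw [h]
  induction j with
  | zero => simp [ascendingWt]
  | succ j ih =>
    rw [Finset.sum_range_succ, ascendingWt_succ_succ]
    linear_combination ih

/-- After exchanging the sums, the coefficient of `g j` for `j ≥ 1` is the left side of
`ascendingWt_add_sum`; only `g 0` survives. -/
theorem sum_ascendingWt_mul {m : ℕ} (hm : 1 ≤ m) (y : R) (g : ℕ → R) :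
    ∑ j ∈ Finset.range m, ascendingWt y j * g j +
      y * ∑ i ∈ Finset.Icc 1 (m - 1), ∑ j ∈ Finset.Ico i m, ascendingWt y (j - i) * g j = g 0 := by
  have h : ∑ i ∈ Finset.Icc 1 (m - 1), ∑ j ∈ Finset.Ico i m, ascendingWt y (j - i) * g j =
      ∑ j ∈ Finset.range m, ∑ i ∈ Finset.Icc 1 j, ascendingWt y (j - i) * g j := by
    refine Finset.sum_comm' fun i j => ?_
    simp only [Finset.mem_Icc, Finset.mem_Ico, Finset.mem_range]
    omega
  rw [h, Finset.mul_sum, ← Finset.sum_add_distrib,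
    Finset.sum_eq_single_of_mem 0 (Finset.mem_range.2 hm)]
  · simp [ascendingWt]
  · intro j _ hj
    obtain ⟨j, rfl⟩ := Nat.exists_eq_succ_of_ne_zero hj
    rw [← Finset.sum_mul, ← mul_assoc, ← add_mul, Nat.succ_eq_add_one, ascendingWt_add_sum,
      zero_mul]

theorem clusterWt_ascending (hk₁ : 2 ≤ k₁) (hk₂ : 2 ≤ k₂) (n : ℕ) :
    ∀ s, (∀ i, s ≤ i → i + 1 < s + n → w i < w (i + 1)) →
      clusterWt k₁ k₂ y w s (s + n) = ascendingWt y n := by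
  induction n with
  | zero => intro s _; rw [clusterWt_nil (by omega)]; rfl
  | succ n ih =>
    intro s h
    rcases n with _ | n
    · rw [zero_add, clusterWt_single]; simp [ascendingWt]
    · have ho : ¬ Occ k₁ k₂ w s (s + (n + 1 + 1)) := by
        intro ho
        have h1 := ho.1
        have h2 := ho.descent hk₁
        have h3 := h (s + (k₁ - 1)) (by omega) (by omega)
        rw [show s + (k₁ - 1) + 1 = s + k₁ by omega] at h3
        omega
      rw [clusterWt_not_occ (by omega) ho, if_pos (h s le_rfl (by omega)), ascendingWt_succ_succ,
        ← ih (s + 1) (fun i hi h1 => h i (by omega) (by omega))]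
      congr 2; omega

theorem avoidWt_nil (h : e ≤ s) : avoidWt k₁ k₂ x y w s e = 1 := by
  rw [avoidWt, if_pos h]

theorem avoidWt_occ (h : Occ k₁ k₂ w s e) (hs : s < e) : avoidWt k₁ k₂ x y w s e = 0 := by
  rw [avoidWt, if_neg (by omega), if_neg fun ha => ha s le_rfl h]

theorem avoidWt_single (hk₁ : 2 ≤ k₁) : avoidWt k₁ k₂ 1 y w s (s + 1) = y := by
  rw [avoidWt, if_neg (by omega), if_pos]
  · simp [descents]
  · intro i hi h
    have := h.1
    omega

theorem avoidWt_step (hs : s + 2 ≤ e) (h : ¬ Occ k₁ k₂ w s e) :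
    avoidWt k₁ k₂ 1 y w s e =
      (if w s < w (s + 1) then 1 else y) * avoidWt k₁ k₂ 1 y w (s + 1) e := by
  have ha : Avoids k₁ k₂ w s e ↔ Avoids k₁ k₂ w (s + 1) e := by
    refine ⟨fun H i hi => H i (by omega), fun H i hi => ?_⟩
    rcases hi.eq_or_lt with rfl | hi
    · exact h
    · exact H i hi
  have hd : descents w s e = (if w s < w (s + 1) then 0 else 1) + descents w (s + 1) e := by
    rw [descents, ← Finset.insert_Ico_add_one_left_eq_Ico (show s < e - 1 by omega),
      Finset.filter_insert]
    by_cases h1 : w s < w (s + 1)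
    · rw [if_neg (not_not.2 h1), if_pos h1, zero_add, descents]
    · rw [if_pos h1, if_neg h1, Finset.card_insert_of_notMem (by simp), add_comm, descents]
  rw [avoidWt, avoidWt, if_neg (show ¬ e ≤ s by omega), if_neg (show ¬ e ≤ s + 1 by omega)]
  by_cases h1 : Avoids k₁ k₂ w s e
  · rw [if_pos h1, if_pos (ha.1 h1), hd]
    split_ifs <;> ring
  · rw [if_neg h1, if_neg fun h2 => h1 (ha.2 h2), mul_zero]

theorem avoidWt_ascending {a b : ℕ} (hab : a ≤ b) (hb : b < e)
    (h : ∀ i, a ≤ i → i < b → ¬ Occ k₁ k₂ w i e ∧ w i < w (i + 1)) :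
    avoidWt k₁ k₂ 1 y w a e = avoidWt k₁ k₂ 1 y w b e := by
  induction b, hab using Nat.le_induction with
  | base => rfl
  | succ b hab ih =>
    obtain ⟨h1, h2⟩ := h b hab (by omega)
    rw [ih (by omega) fun i hi hib => h i hi (by omega), avoidWt_step (by omega) h1, if_pos h2,
      one_mul]

theorem Occ.of_le {e' : ℕ} (h : Occ k₁ k₂ w s e') (he : e' ≤ e) : Occ k₁ k₂ w s e :=
  ⟨h.1.trans he, h.2⟩

theorem Occ.restrict {e' : ℕ} (h : Occ k₁ k₂ w s e) (he : s + (k₁ + k₂) ≤ e') :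
    Occ k₁ k₂ w s e' :=
  ⟨he, h.2⟩

/-- The part of the convolution coming from prefixes that end inside the initial occurrence. -/
theorem Occ.sum_short (hk₁ : 2 ≤ k₁) (hk₂ : 2 ≤ k₂) (h : Occ k₁ k₂ w s e) :
    ∑ k ∈ Finset.Ico (s + 1) (s + (k₁ + k₂)),
      clusterWt k₁ k₂ y w s k * avoidWt k₁ k₂ 1 y w k e =
    -y * avoidWt k₁ k₂ 1 y w (s + max k₁ k₂) e := by
  have he := h.1
  have hM := le_max_left k₁ k₂
  have hM' : max k₁ k₂ < k₁ + k₂ := by omega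
  rw [← Finset.sum_Ico_consecutive _ (show s + 1 ≤ s + 1 + k₁ by omega)
    (show s + 1 + k₁ ≤ s + (k₁ + k₂) by omega)]
  -- Between positions `k₁` and `max k₁ k₂` of the occurrence there are only ascents and no new
  -- occurrence starts, so dropping these letters costs nothing.
  have hlast : avoidWt k₁ k₂ 1 y w (s + k₁) e = avoidWt k₁ k₂ 1 y w (s + max k₁ k₂) e := by
    refine avoidWt_ascending (by omega) (by omega) fun i hi hiM => ?_
    obtain ⟨t, rfl⟩ := Nat.exists_eq_add_of_le (show s ≤ i by omega)
    exact ⟨h.not_occ_of_lt hk₁ (by omega) (by omega), h.2.2.1 t (by omega) (by omega)⟩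
  -- A suffix starting inside the first run, after its first entry, still contains the descent
  -- between the runs, which gives the factor `y`.
  have hfirst : ∀ j, j + 1 < k₁ → avoidWt k₁ k₂ 1 y w (s + 1 + j) e =
      y * avoidWt k₁ k₂ 1 y w (s + max k₁ k₂) e := by
    intro j hj
    rw [avoidWt_ascending (b := s + (k₁ - 1)) (by omega) (by omega), avoidWt_step (by omega)
      (h.not_occ_of_lt hk₁ (by omega) (by omega)), if_neg, ← hlast]
    · congr 2; omega
    · have := h.descent hk₁
      rw [show s + (k₁ - 1) + 1 = s + k₁ by omega]; omega
    · intro i hi hik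
      obtain ⟨t, rfl⟩ := Nat.exists_eq_add_of_le (show s ≤ i by omega)
      exact ⟨h.not_occ_of_lt hk₁ (by omega) (by omega), h.2.1 t (by omega)⟩
  -- These prefixes are too short for an occurrence, and after removing the first entry they no
  -- longer start with their minimum, because the second run starts below position 1.
  have hzero : ∑ k ∈ Finset.Ico (s + 1 + k₁) (s + (k₁ + k₂)),
      clusterWt k₁ k₂ y w s k * avoidWt k₁ k₂ 1 y w k e = 0 := by
    refine Finset.sum_eq_zero fun k hk => ?_
    rw [Finset.mem_Ico] at hk
    rw [clusterWt_not_occ (by omega) (fun ho => by have := ho.1; omega)]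
    have : clusterWt k₁ k₂ y w (s + 1) k = 0 := by
      by_contra hne
      exact (head_lt_of_clusterWt_ne_zero hk₁ hk₂ hne (s + k₁) (by omega) (by omega)).not_gt
        h.2.2.2.2
    simp [this]
  have hcl : ∀ j, j < k₁ → clusterWt k₁ k₂ y w s (s + 1 + j) = -y * (1 - y) ^ j := by
    intro j hj
    rw [add_right_comm, add_assoc, clusterWt_ascending hk₁ hk₂ (j + 1)]
    · simp [ascendingWt]
    · intro i hi hij
      obtain ⟨t, rfl⟩ := Nat.exists_eq_add_of_le hi
      exact h.2.1 t (by omega)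
  have hsum : ∀ j ∈ Finset.range (k₁ - 1), clusterWt k₁ k₂ y w s (s + 1 + j) *
      avoidWt k₁ k₂ 1 y w (s + 1 + j) e =
      -y * (1 - y) ^ j * (y * avoidWt k₁ k₂ 1 y w (s + max k₁ k₂) e) := by
    intro j hj
    rw [Finset.mem_range] at hj
    rw [hcl j (by omega), hfirst j (by omega)]
  rw [hzero, add_zero, Finset.sum_Ico_eq_sum_range, Nat.add_sub_cancel_left,
    show k₁ = k₁ - 1 + 1 by omega, Finset.sum_range_succ, ← show k₁ = k₁ - 1 + 1 by omega,
    hcl _ (by omega), show s + 1 + (k₁ - 1) = s + k₁ by omega, hlast,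
    Finset.sum_congr rfl hsum,
    ← Finset.sum_mul, ← Finset.mul_sum]
  -- The geometric sum over the first run, times `y`, is `1 - (1 - y) ^ (k₁ - 1)`; the cut at the
  -- start of the second run supplies the missing power.
  have hg := mul_neg_geom_sum (1 - y) (k₁ - 1)
  linear_combination (-y * avoidWt k₁ k₂ 1 y w (s + max k₁ k₂) e) * hg

/-- The cluster weight is a one-sided inverse of the avoidance weight under deconcatenation. -/
theorem sum_clusterWt_mul_avoidWt (hk₁ : 2 ≤ k₁) (hk₂ : 2 ≤ k₂) : ∀ {s : ℕ}, s < e →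
    ∑ k ∈ Finset.Icc s e, clusterWt k₁ k₂ y w s k * avoidWt k₁ k₂ 1 y w k e = 0 := by
  suffices H : ∀ n s, e - s = n → s < e →
      ∑ k ∈ Finset.Icc s e, clusterWt k₁ k₂ y w s k * avoidWt k₁ k₂ 1 y w k e = 0 from
    fun {s} => H (e - s) s rfl
  intro n
  induction n using Nat.strong_induction_on with
  | _ n ih =>
  intro s hn hs
  rw [← Finset.insert_Icc_add_one_left_eq_Icc hs.le, Finset.sum_insert (by simp),
    clusterWt_nil le_rfl, one_mul]
  by_cases ho : Occ k₁ k₂ w s e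
  · have he := ho.1
    have hm : max k₁ k₂ + min k₁ k₂ = k₁ + k₂ := by omega
    set M := max k₁ k₂ with hMdef
    set m := min k₁ k₂ with hmdef
    have hm2 : 2 ≤ m := by omega
    have hM2 : k₁ ≤ M := by omega
    have hIcc : Finset.Icc (s + 1) e = Finset.Ico (s + 1) (e + 1) := rfl
    rw [avoidWt_occ ho hs, zero_add, hIcc, ← Finset.sum_Ico_consecutive _
      (show s + 1 ≤ s + (k₁ + k₂) by omega) (show s + (k₁ + k₂) ≤ e + 1 by omega),
      ho.sum_short hk₁ hk₂]
    -- The suffix at `s + (M + i)` starts in the second run. Its vanishing convolution is split at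
    -- the end of the occurrence, and inside the occurrence its prefixes are increasing.
    have htail : ∀ i, i < m → ∑ k ∈ Finset.Ico (s + (k₁ + k₂)) (e + 1),
        clusterWt k₁ k₂ y w (s + (M + i)) k * avoidWt k₁ k₂ 1 y w k e =
        -∑ j ∈ Finset.Ico i m, ascendingWt y (j - i) * avoidWt k₁ k₂ 1 y w (s + M + j) e := by
      intro i hi
      have h1 := ih (e - (s + (M + i))) (by omega) (s + (M + i)) rfl (by omega)
      have hIcc : Finset.Icc (s + (M + i)) e = Finset.Ico (s + (M + i)) (e + 1) := rfl
      rw [hIcc, ← Finset.sum_Ico_consecutive _ (show s + (M + i) ≤ s + (k₁ + k₂) by omega)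
        (show s + (k₁ + k₂) ≤ e + 1 by omega)] at h1
      rw [eq_neg_iff_add_eq_zero, add_comm, ← h1]
      congr 1
      rw [show s + (k₁ + k₂) = m + (s + M) by omega, show s + (M + i) = i + (s + M) by omega,
        ← Finset.sum_Ico_add']
      refine Finset.sum_congr rfl fun j hj => ?_
      rw [Finset.mem_Ico] at hj
      rw [show j + (s + M) = i + (s + M) + (j - i) by omega, clusterWt_ascending hk₁ hk₂ (j - i)]
      · congr 2; omega
      · intro a ha haj
        obtain ⟨t, rfl⟩ := Nat.exists_eq_add_of_le (show s ≤ a by omega)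
        exact ho.2.2.1 t (by omega) (by omega)
    have hlong : ∑ k ∈ Finset.Ico (s + (k₁ + k₂)) (e + 1),
        clusterWt k₁ k₂ y w s k * avoidWt k₁ k₂ 1 y w k e =
        -y * (∑ k ∈ Finset.Ico (s + (k₁ + k₂)) (e + 1),
            clusterWt k₁ k₂ y w (s + (M + 0)) k * avoidWt k₁ k₂ 1 y w k e +
          y * ∑ i ∈ Finset.Icc 1 (m - 1), ∑ k ∈ Finset.Ico (s + (k₁ + k₂)) (e + 1),
            clusterWt k₁ k₂ y w (s + (M + i)) k * avoidWt k₁ k₂ 1 y w k e) := by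
      rw [Finset.sum_comm, Finset.mul_sum, ← Finset.sum_add_distrib, Finset.mul_sum]
      refine Finset.sum_congr rfl fun k hk => ?_
      rw [Finset.mem_Ico] at hk
      rw [clusterWt_occ hk₁ (ho.restrict hk.1), ← Finset.sum_mul, add_zero]
      ring
    rw [hlong, htail 0 (by omega), Finset.sum_congr rfl fun i hi => htail i (by
      rw [Finset.mem_Icc] at hi; omega), Finset.sum_neg_distrib]
    -- The tails collapse to the avoidance weight at `s + M`, which cancels the contribution of the
    -- short prefixes.
    have := sum_ascendingWt_mul (show 1 ≤ m by omega) y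
      fun j => avoidWt k₁ k₂ 1 y w (s + M + j) e
    simp only [Finset.range_eq_Ico, Nat.sub_zero, add_zero] at this ⊢
    linear_combination y * this
  · rcases (show s + 1 ≤ e from hs).eq_or_lt with rfl | hs2
    · rw [avoidWt_single hk₁]
      simp [clusterWt_single, avoidWt_nil]
    -- Without an initial occurrence everything is a multiple of the avoidance weight from `s + 1`:
    -- the coefficients add up to `1 - y - (1 - y)` at an ascent and to `y - y` otherwise.
    · have h1 := ih (e - (s + 1)) (by omega) (s + 1) rfl (by omega)
      rw [← Finset.insert_Icc_add_one_left_eq_Icc (show s + 1 ≤ e by omega),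
        Finset.sum_insert (by simp)] at h1 ⊢
      rw [clusterWt_nil le_rfl, one_mul] at h1
      have hstep : ∀ k ∈ Finset.Icc (s + 1 + 1) e,
          clusterWt k₁ k₂ y w s k * avoidWt k₁ k₂ 1 y w k e =
          (if w s < w (s + 1) then (1 - y) * clusterWt k₁ k₂ y w (s + 1) k else 0) *
            avoidWt k₁ k₂ 1 y w k e := by
        intro k hk
        rw [Finset.mem_Icc] at hk
        rw [clusterWt_not_occ (by omega) fun h => ho (h.of_le hk.2)]
      rw [avoidWt_step hs2 ho, clusterWt_single, Finset.sum_congr rfl hstep]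
      by_cases hlt : w s < w (s + 1)
      · simp only [if_pos hlt, mul_assoc]
        rw [← Finset.mul_sum]
        linear_combination (1 - y) * h1
      · simp only [if_neg hlt, zero_mul, Finset.sum_const_zero]
        ring

end WordIdentity

/-! ### Order invariance, and cutting a word at its minimum -/

/-- A word functional is order invariant if its value on `w s, …, w (e - 1)` depends only on the
relative order of these entries. -/
def OrderInvariant {R : Type*} (F : (ℕ → ℕ) → ℕ → ℕ → R) : Prop :=
  ∀ (n : ℕ) (w w' : ℕ → ℕ) (s s' : ℕ),
    (∀ i < n, ∀ j < n, (w (s + i) < w (s + j) ↔ w' (s' + i) < w' (s' + j))) →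
      F w s (s + n) = F w' s' (s' + n)

section Invariance

variable {R : Type*} [CommRing R] {k₁ k₂ : ℕ} {w w' : ℕ → ℕ} {s e : ℕ} {x y : R}

theorem Occ.congr {n s' i : ℕ} (hk₁ : 2 ≤ k₁) (hk₂ : 2 ≤ k₂)
    (hw : ∀ i < n, ∀ j < n, (w (s + i) < w (s + j) ↔ w' (s' + i) < w' (s' + j)))
    (h : Occ k₁ k₂ w (s + i) (s + n)) : Occ k₁ k₂ w' (s' + i) (s' + n) := by
  obtain ⟨h1, h2, h3, h4, h5⟩ := h
  simp only [add_assoc] at h2 h3 h4 h5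
  refine ⟨by omega, fun a ha => ?_, fun a ha ha' => ?_, ?_, ?_⟩ <;> simp only [add_assoc]
  · exact (hw _ (by omega) _ (by omega)).1 (h2 a ha)
  · exact (hw _ (by omega) _ (by omega)).1 (h3 a ha ha')
  · exact (hw _ (by omega) _ (by omega)).1 h4
  · exact (hw _ (by omega) _ (by omega)).1 h5

theorem occ_congr {n s' i : ℕ} (hk₁ : 2 ≤ k₁) (hk₂ : 2 ≤ k₂)
    (hw : ∀ i < n, ∀ j < n, (w (s + i) < w (s + j) ↔ w' (s' + i) < w' (s' + j))) :
    Occ k₁ k₂ w (s + i) (s + n) ↔ Occ k₁ k₂ w' (s' + i) (s' + n) :=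
  ⟨Occ.congr hk₁ hk₂ hw, Occ.congr hk₁ hk₂ fun i hi j hj => (hw i hi j hj).symm⟩

theorem orderInvariant_clusterWt (hk₁ : 2 ≤ k₁) (hk₂ : 2 ≤ k₂) (y : R) :
    OrderInvariant (clusterWt k₁ k₂ y) := by
  intro n
  induction n using Nat.strong_induction_on with
  | _ n ih =>
  intro w w' s s' hw
  have hM := le_max_left k₁ k₂
  have hsub : ∀ t, 1 ≤ t → t < n →
      clusterWt k₁ k₂ y w (s + t) (s + n) = clusterWt k₁ k₂ y w' (s' + t) (s' + n) := by
    intro t ht htn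
    have := ih (n - t) (by omega) w w' (s + t) (s' + t) fun i hi j hj => by
      simpa only [add_assoc] using hw (t + i) (by omega) (t + j) (by omega)
    rwa [show s + t + (n - t) = s + n by omega, show s' + t + (n - t) = s' + n by omega] at this
  rcases n with _ | _ | n
  · rw [clusterWt_nil (by omega), clusterWt_nil (by omega)]
  · rw [zero_add, clusterWt_single, clusterWt_single]
  · have hiff := occ_congr (i := 0) hk₁ hk₂ hw
    rw [add_zero, add_zero] at hiff
    by_cases ho : Occ k₁ k₂ w s (s + (n + 1 + 1))
    · have hlen := ho.1
      rw [clusterWt_occ hk₁ ho, clusterWt_occ hk₁ (hiff.1 ho), hsub _ (by omega) (by omega),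
        Finset.sum_congr rfl fun i hi => ?_]
      rw [Finset.mem_Icc] at hi
      exact hsub _ (by omega) (by omega)
    · rw [clusterWt_not_occ (by omega) ho, clusterWt_not_occ (by omega) (mt hiff.2 ho),
        hsub 1 le_rfl (by omega)]
      have := hw 0 (by omega) 1 (by omega)
      rw [add_zero, add_zero] at this
      simp only [this]

theorem leftMinima_add (w : ℕ → ℕ) (s n : ℕ) : leftMinima w s (s + n) =
    open Classical in
    ((Finset.range n).filter fun j => ∀ i < j, w (s + j) < w (s + i)).card := by
  classical
  rw [leftMinima]
  refine Finset.card_nbij' (fun j => j - s) (fun j => s + j) ?_ ?_ ?_ ?_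
  · intro j hj
    simp only [Finset.coe_filter, Finset.mem_Ico, Finset.mem_range, Set.mem_ofPred_eq] at hj ⊢
    refine ⟨by omega, fun i hi => ?_⟩
    have := hj.2 (s + i) (by omega) (by omega)
    rwa [show s + (j - s) = j by omega]
  · intro j hj
    simp only [Finset.coe_filter, Finset.mem_Ico, Finset.mem_range, Set.mem_ofPred_eq] at hj ⊢
    refine ⟨by omega, fun i hi hij => ?_⟩
    have := hj.2 (i - s) (by omega)
    rwa [show s + (i - s) = i by omega] at this
  · intro j hj
    simp only [Finset.coe_filter, Finset.mem_Ico, Set.mem_ofPred_eq] at hj ⊢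
    omega
  · intro j _
    simp

theorem descents_add (w : ℕ → ℕ) (s n : ℕ) : descents w s (s + n) =
    ((Finset.range (n - 1)).filter fun i => ¬ w (s + i) < w (s + (i + 1))).card := by
  rw [descents]
  refine Finset.card_nbij' (fun j => j - s) (fun j => s + j) ?_ ?_ ?_ ?_
  · intro j hj
    simp only [Finset.coe_filter, Finset.mem_Ico, Finset.mem_range, Set.mem_ofPred_eq] at hj ⊢
    refine ⟨by omega, ?_⟩
    rw [show s + (j - s) = j by omega, show s + (j - s + 1) = j + 1 by omega]
    exact hj.2
  · intro j hj
    simp only [Finset.coe_filter, Finset.mem_Ico, Finset.mem_range, Set.mem_ofPred_eq] at hj ⊢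
    exact ⟨by omega, hj.2⟩
  · intro j hj
    simp only [Finset.coe_filter, Finset.mem_Ico, Set.mem_ofPred_eq] at hj ⊢
    omega
  · intro j _
    simp

theorem avoids_iff (w : ℕ → ℕ) (s n : ℕ) :
    Avoids k₁ k₂ w s (s + n) ↔ ∀ i, ¬ Occ k₁ k₂ w (s + i) (s + n) := by
  refine ⟨fun h i => h _ (by omega), fun h i hi => ?_⟩
  obtain ⟨t, rfl⟩ := Nat.exists_eq_add_of_le hi
  exact h t

theorem orderInvariant_avoidWt (hk₁ : 2 ≤ k₁) (hk₂ : 2 ≤ k₂) (x y : R) :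
    OrderInvariant (avoidWt k₁ k₂ x y) := by
  intro n w w' s s' hw
  have h1 : leftMinima w s (s + n) = leftMinima w' s' (s' + n) := by
    classical
    rw [leftMinima_add, leftMinima_add]
    congr 1
    refine Finset.filter_congr fun j hj => ?_
    rw [Finset.mem_range] at hj
    exact forall₂_congr fun i hi => hw j hj i (by omega)
  have h2 : descents w s (s + n) = descents w' s' (s' + n) := by
    rw [descents_add, descents_add]
    congr 1
    refine Finset.filter_congr fun j hj => ?_
    rw [Finset.mem_range] at hj
    rw [hw j (by omega) (j + 1) (by omega)]
  have h3 : Avoids k₁ k₂ w s (s + n) ↔ Avoids k₁ k₂ w' s' (s' + n) := by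
    rw [avoids_iff, avoids_iff]
    exact forall_congr' fun i => not_congr (occ_congr hk₁ hk₂ hw)
  rw [avoidWt, avoidWt, h1, h2]
  by_cases h4 : Avoids k₁ k₂ w s (s + n)
  · simp only [if_pos h4, if_pos (h3.1 h4), show s + n ≤ s ↔ s' + n ≤ s' by omega]
  · simp only [if_neg h4, if_neg (mt h3.2 h4), show s + n ≤ s ↔ s' + n ≤ s' by omega]

theorem leftMinima_split {m : ℕ} (hsm : s ≤ m) (hme : m < e)
    (h : ∀ i, s ≤ i → i < e → i ≠ m → w m < w i) :
    leftMinima w s e = leftMinima w s m + 1 := by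
  classical
  rw [leftMinima, leftMinima, ← Finset.card_insert_of_notMem (a := m) (by simp)]
  congr 1
  ext j
  simp only [Finset.mem_filter, Finset.mem_Ico, Finset.mem_insert]
  constructor
  · rintro ⟨hj, hj'⟩
    rcases lt_trichotomy j m with h1 | h1 | h1
    · exact Or.inr ⟨by omega, hj'⟩
    · exact Or.inl h1
    · have := hj' m hsm h1
      have := h j (by omega) (by omega) (by omega)
      omega
  · rintro (rfl | ⟨hj, hj'⟩)
    · exact ⟨by omega, fun i hi hij => h i hi (by omega) (by omega)⟩
    · exact ⟨by omega, hj'⟩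

theorem descents_split {m : ℕ} (hsm : s < m) (hme : m < e)
    (h : ∀ i, s ≤ i → i < e → i ≠ m → w m < w i) :
    descents w s e = descents w s m + 1 + descents w m e := by
  simp only [descents, Finset.card_filter]
  rw [← Finset.sum_Ico_consecutive _ (show s ≤ m by omega) (show m ≤ e - 1 by omega)]
  congr 1
  obtain ⟨m, rfl⟩ := Nat.exists_eq_succ_of_ne_zero (show m ≠ 0 by omega)
  rw [Nat.succ_eq_add_one, Nat.add_sub_cancel, Finset.sum_Ico_succ_top (by omega), if_pos]
  exact (h m (by omega) (by omega) (by omega)).not_gt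

/-- An occurrence starts with its strict minimum, so one that starts before the overall minimum `m`
cannot contain `m`. -/
theorem avoids_split {m : ℕ} (hsm : s ≤ m) (hme : m < e)
    (h : ∀ i, s ≤ i → i < e → i ≠ m → w m < w i) :
    Avoids k₁ k₂ w s e ↔ Avoids k₁ k₂ w s m ∧ Avoids k₁ k₂ w m e := by
  constructor
  · exact fun H => ⟨fun i hi ho => H i hi (ho.of_le hme.le), fun i hi => H i (by omega)⟩
  · rintro ⟨H1, H2⟩ i hi ho
    rcases le_or_gt m i with h1 | h1
    · exact H2 i h1 ho
    · rcases le_or_gt (i + (k₁ + k₂)) m with h2 | h2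
      · exact H1 i hi (ho.restrict h2)
      · have h3 := ho.head_lt (j := m - i) (by omega) (by omega)
        rw [show i + (m - i) = m by omega] at h3
        exact h3.not_gt (h i hi (by omega) (by omega))

/-- The minimum is the one left-to-right minimum not counted on the left, hence the factor `x`. The
descent into it accounts for the second `1 +` in the exponents of `y`; for an empty left part that
descent is missing, which the value 1 of `avoidWt` on empty words compensates. -/
theorem avoidWt_split {m : ℕ} (hsm : s ≤ m) (hme : m < e)
    (h : ∀ i, s ≤ i → i < e → i ≠ m → w m < w i) :
    avoidWt k₁ k₂ x y w s e = avoidWt k₁ k₂ x y w s m * (x * avoidWt k₁ k₂ 1 y w m e) := by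
  have ha := avoids_split (k₁ := k₁) (k₂ := k₂) hsm hme h
  have hl := leftMinima_split hsm hme h
  rw [avoidWt, avoidWt, avoidWt, if_neg (show ¬ e ≤ s by omega), if_neg (show ¬ e ≤ m by omega)]
  by_cases h2 : Avoids k₁ k₂ w m e
  · rcases hsm.eq_or_lt with rfl | hsm
    · rw [if_pos h2, if_pos le_rfl, if_pos h2, hl]
      simp [leftMinima]
    · rw [if_neg (show ¬ m ≤ s by omega)]
      by_cases h1 : Avoids k₁ k₂ w s m
      · rw [if_pos (ha.2 ⟨h1, h2⟩), if_pos h1, if_pos h2, hl, descents_split hsm hme h]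
        ring
      · rw [if_neg fun H => h1 (ha.1 H).1, if_neg h1, zero_mul]
  · rw [if_neg fun H => h2 (ha.1 H).2, if_neg h2, mul_zero, mul_zero]

end Invariance

/-! ### Sums over arrangements of a finite set -/

/-- The arrangements of a finite set `S`, as lists. -/
def arrangements (S : Finset ℕ) : Finset (List ℕ) := (Multiset.lists S.val).toFinset

/-- The value of a word functional on a list. -/
def onList {R : Type*} (F : (ℕ → ℕ) → ℕ → ℕ → R) (l : List ℕ) : R :=
  F (fun i => l.getD i 0) 0 l.length

/-- The sum of a word functional over all arrangements of `{0, …, n - 1}`. -/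
def wordSum {R : Type*} [AddCommMonoid R] (F : (ℕ → ℕ) → ℕ → ℕ → R) (n : ℕ) : R :=
  ∑ l ∈ arrangements (Finset.range n), onList F l

section Arrangements

variable {R : Type*} {F : (ℕ → ℕ) → ℕ → ℕ → R} {S T : Finset ℕ} {l p q : List ℕ}

theorem mem_arrangements : l ∈ arrangements S ↔ l.Nodup ∧ l.toFinset = S := by
  rw [arrangements, Multiset.mem_toFinset, Multiset.mem_lists_iff]
  constructor
  · intro h
    have hn : l.Nodup := by
      have := S.nodup
      rw [h] at this
      exact this
    refine ⟨hn, Finset.val_injective ?_⟩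
    rw [List.toFinset_val, hn.dedup, h]
    rfl
  · rintro ⟨hn, rfl⟩
    rw [List.toFinset_val, hn.dedup]
    rfl

theorem length_of_mem_arrangements (h : l ∈ arrangements S) : l.length = S.card := by
  rw [mem_arrangements] at h
  rw [← h.2, List.toFinset_card_of_nodup h.1]

theorem mem_iff_of_mem_arrangements (h : l ∈ arrangements S) {a : ℕ} : a ∈ l ↔ a ∈ S := by
  rw [mem_arrangements] at h
  rw [← h.2, List.mem_toFinset]

theorem arrangements_empty : arrangements ∅ = {[]} := by
  ext l
  rw [mem_arrangements, Finset.mem_singleton, List.toFinset_eq_empty_iff]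
  exact ⟨fun h => h.2, fun h => ⟨h ▸ List.nodup_nil, h⟩⟩

theorem append_mem_arrangements (hT : T ⊆ S) (hp : p ∈ arrangements T)
    (hq : q ∈ arrangements (S \ T)) : p ++ q ∈ arrangements S := by
  have hp' := mem_arrangements.1 hp
  have hq' := mem_arrangements.1 hq
  rw [mem_arrangements, List.toFinset_append, hp'.2, hq'.2, Finset.union_sdiff_of_subset hT]
  refine ⟨hp'.1.append hq'.1 fun a h1 h2 => ?_, rfl⟩
  rw [mem_iff_of_mem_arrangements hp] at h1
  rw [mem_iff_of_mem_arrangements hq] at h2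
  exact (Finset.mem_sdiff.1 h2).2 h1

theorem drop_mem_arrangements (hl : l ∈ arrangements S) (k : ℕ) :
    l.drop k ∈ arrangements (S \ (l.take k).toFinset) := by
  obtain ⟨hn, rfl⟩ := mem_arrangements.1 hl
  refine mem_arrangements.2 ⟨hn.sublist (List.drop_sublist k l), ?_⟩
  have h1 : Disjoint (l.drop k).toFinset (l.take k).toFinset := by
    rw [List.disjoint_toFinset_iff_disjoint]
    exact (List.disjoint_take_drop hn le_rfl).symm
  conv_rhs => rw [← List.take_append_drop k l]
  rw [List.toFinset_append, List.take_append_drop, Finset.union_sdiff_cancel_left h1.symm]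

theorem take_mem_arrangements (hl : l ∈ arrangements S) (k : ℕ) :
    l.take k ∈ arrangements (l.take k).toFinset :=
  mem_arrangements.2 ⟨(mem_arrangements.1 hl).1.sublist (List.take_sublist k l), rfl⟩

/-- Arrangements are cut after position `k`. -/
theorem sum_arrangements_take_drop [AddCommMonoid R] {k : ℕ} (hk : k ≤ S.card)
    (h : List ℕ → List ℕ → R) :
    ∑ l ∈ arrangements S, h (l.take k) (l.drop k) =
      ∑ T ∈ S.powersetCard k, ∑ p ∈ arrangements T, ∑ q ∈ arrangements (S \ T), h p q := by
  have hmaps : ∀ l ∈ arrangements S, (l.take k).toFinset ∈ S.powersetCard k := by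
    intro l hl
    rw [Finset.mem_powersetCard, ← length_of_mem_arrangements (take_mem_arrangements hl k),
      List.length_take, length_of_mem_arrangements hl]
    refine ⟨fun a ha => ?_, by omega⟩
    rw [List.mem_toFinset] at ha
    exact (mem_iff_of_mem_arrangements hl).1 (List.mem_of_mem_take ha)
  rw [← Finset.sum_fiberwise_of_maps_to hmaps]
  refine Finset.sum_congr rfl fun T hT => ?_
  rw [Finset.mem_powersetCard] at hT
  rw [← Finset.sum_product']
  refine Finset.sum_bij' (fun l _ => (l.take k, l.drop k)) (fun pq _ => pq.1 ++ pq.2)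
    ?_ ?_ ?_ ?_ ?_
  · intro l hl
    obtain ⟨hl', rfl⟩ := Finset.mem_filter.1 hl
    exact Finset.mem_product.2 ⟨take_mem_arrangements hl' k, drop_mem_arrangements hl' k⟩
  · rintro ⟨p, q⟩ hpq
    obtain ⟨hp, hq⟩ := Finset.mem_product.1 hpq
    refine Finset.mem_filter.2 ⟨append_mem_arrangements hT.1 hp hq, ?_⟩
    rw [List.take_left' ((length_of_mem_arrangements hp).trans hT.2)]
    exact (mem_arrangements.1 hp).2
  · intro l _
    exact List.take_append_drop k l
  · rintro ⟨p, q⟩ hpq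
    obtain ⟨hp, hq⟩ := Finset.mem_product.1 hpq
    have := (length_of_mem_arrangements hp).trans hT.2
    simp only [List.take_left' this, List.drop_left' this]
  · intro l _
    rfl

/-- Arrangements are cut after their first entry. -/
theorem sum_arrangements_cons [AddCommMonoid R] (hS : S.Nonempty) (h : List ℕ → R) :
    ∑ l ∈ arrangements S, h l = ∑ a ∈ S, ∑ q ∈ arrangements (S.erase a), h (a :: q) := by
  have := sum_arrangements_take_drop (k := 1) (Finset.card_pos.2 hS) (fun p q => h (p ++ q))
  simp only [List.take_append_drop] at this
  rw [this, Finset.powersetCard_one, Finset.sum_map]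
  refine Finset.sum_congr rfl fun a _ => ?_
  have : arrangements {a} = {[a]} := by
    ext l
    rw [mem_arrangements, Finset.mem_singleton]
    constructor
    · rintro ⟨hn, hl⟩
      have h1 : l.length = 1 := by rw [← List.toFinset_card_of_nodup hn, hl, Finset.card_singleton]
      obtain ⟨b, rfl⟩ := List.length_eq_one_iff.1 h1
      simpa using hl
    · rintro rfl
      simp
  simp only [Function.Embedding.coeFn_mk, this, Finset.sum_singleton,
    Finset.sdiff_singleton_eq_erase, List.singleton_append]

/-- Arrangements are cut at the position of a given entry. -/
theorem sum_arrangements_insert [AddCommMonoid R] {a : ℕ} (ha : a ∉ S) (h : List ℕ → R) :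
    ∑ l ∈ arrangements (insert a S), h l =
      ∑ T ∈ S.powerset, ∑ p ∈ arrangements T, ∑ q ∈ arrangements (S \ T), h (p ++ a :: q) := by
  have hsplit : ∀ l ∈ arrangements (insert a S),
      l.take (l.idxOf a) ++ a :: l.drop (l.idxOf a + 1) = l := by
    intro l hl
    have hal : a ∈ l := (mem_iff_of_mem_arrangements hl).2 (Finset.mem_insert_self a S)
    have hlt := List.idxOf_lt_length_of_mem hal
    conv_rhs => rw [← List.take_append_drop (l.idxOf a) l, List.drop_eq_getElem_cons hlt,
      List.getElem_idxOf hlt]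
  have hdec : ∀ {p q : List ℕ}, p ++ a :: q ∈ arrangements (insert a S) →
      p.toFinset ⊆ S ∧ p ∈ arrangements p.toFinset ∧ q ∈ arrangements (S \ p.toFinset) := by
    intro p q hpq
    obtain ⟨hn, hS⟩ := mem_arrangements.1 hpq
    rw [List.nodup_append] at hn
    obtain ⟨hp, hq, hd⟩ := hn
    rw [List.nodup_cons] at hq
    have hmem : ∀ b, b ∈ p ∨ b = a ∨ b ∈ q ↔ b = a ∨ b ∈ S := by
      intro b
      rw [← Finset.mem_insert, ← hS, List.mem_toFinset, List.mem_append, List.mem_cons]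
    refine ⟨fun b hb => ?_, mem_arrangements.2 ⟨hp, rfl⟩, mem_arrangements.2 ⟨hq.2, ?_⟩⟩
    · rw [List.mem_toFinset] at hb
      have := hd b hb a (by simp)
      exact ((hmem b).1 (Or.inl hb)).resolve_left this
    · ext b
      rw [List.mem_toFinset, Finset.mem_sdiff, List.mem_toFinset]
      constructor
      · intro hb
        have h1 : b ≠ a := fun h => hq.1 (h ▸ hb)
        exact ⟨((hmem b).1 (Or.inr (Or.inr hb))).resolve_left h1,
          fun h2 => hd b h2 b (by simp [hb]) rfl⟩
      · rintro ⟨h1, h2⟩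
        have h3 : b ≠ a := fun h => ha (h ▸ h1)
        exact (((hmem b).2 (Or.inr h1)).resolve_left h2).resolve_left h3
  have hmaps : ∀ l ∈ arrangements (insert a S), (l.take (l.idxOf a)).toFinset ∈ S.powerset := by
    intro l hl
    have h1 := hl
    rw [← hsplit l hl] at h1
    exact Finset.mem_powerset.2 (hdec h1).1
  rw [← Finset.sum_fiberwise_of_maps_to hmaps]
  refine Finset.sum_congr rfl fun T hT => ?_
  rw [Finset.mem_powerset] at hT
  rw [← Finset.sum_product']
  have hidx : ∀ {p q : List ℕ}, p ∈ arrangements T → (p ++ a :: q).idxOf a = p.length := by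
    intro p q hp
    have : a ∉ p := fun h => ha (hT ((mem_iff_of_mem_arrangements hp).1 h))
    rw [List.idxOf_append_of_notMem this, List.idxOf_cons_self, add_zero]
  refine Finset.sum_bij' (fun l _ => (l.take (l.idxOf a), l.drop (l.idxOf a + 1)))
    (fun pq _ => pq.1 ++ a :: pq.2) ?_ ?_ ?_ ?_ ?_
  · intro l hl
    obtain ⟨hl', rfl⟩ := Finset.mem_filter.1 hl
    have h1 := hl'
    rw [← hsplit l hl'] at h1
    exact Finset.mem_product.2 (hdec h1).2
  · rintro ⟨p, q⟩ hpq
    obtain ⟨hp, hq⟩ := Finset.mem_product.1 hpq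
    refine Finset.mem_filter.2 ⟨?_, ?_⟩
    · have hT' : T ⊆ insert a S := hT.trans (Finset.subset_insert a S)
      refine append_mem_arrangements hT' hp ?_
      have haT : a ∉ T := fun h => ha (hT h)
      obtain ⟨h1, h2⟩ := mem_arrangements.1 hq
      rw [mem_arrangements, List.nodup_cons, List.toFinset_cons, h2,
        Finset.insert_sdiff_of_notMem _ haT]
      exact ⟨⟨fun h => ha (Finset.mem_sdiff.1 ((mem_iff_of_mem_arrangements hq).1 h)).1, h1⟩, rfl⟩
    · simp only [hidx hp, List.take_left']
      exact (mem_arrangements.1 hp).2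
  · intro l hl
    exact hsplit l (Finset.mem_filter.1 hl).1
  · rintro ⟨p, q⟩ hpq
    obtain ⟨hp, hq⟩ := Finset.mem_product.1 hpq
    simp only [hidx hp, List.take_left', List.drop_append, List.drop_of_length_le (Nat.le_succ _)]
    simp
  · intro l hl
    rw [hsplit l (Finset.mem_filter.1 hl).1]

theorem OrderInvariant.eq_onList (hF : OrderInvariant F) {w : ℕ → ℕ} {s : ℕ} (l : List ℕ)
    (h : ∀ i < l.length, w (s + i) = l.getD i 0) : F w s (s + l.length) = onList F l := by
  rw [onList, hF l.length w (fun i => l.getD i 0) s 0, zero_add]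
  intro i hi j hj
  rw [h i hi, h j hj, zero_add, zero_add]

theorem OrderInvariant.take (hF : OrderInvariant F) {k : ℕ} (hk : k ≤ l.length) :
    F (fun i => l.getD i 0) 0 k = onList F (l.take k) := by
  have hlen : (l.take k).length = k := by rw [List.length_take]; omega
  rw [← hF.eq_onList (w := fun i => l.getD i 0) (s := 0), hlen, zero_add]
  intro i hi
  rw [hlen] at hi
  simp [List.getD, hi]

theorem OrderInvariant.drop (hF : OrderInvariant F) {k : ℕ} (hk : k ≤ l.length) :
    F (fun i => l.getD i 0) k l.length = onList F (l.drop k) := by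
  rw [← hF.eq_onList (w := fun i => l.getD i 0) (s := k), List.length_drop]
  · congr 1
    omega
  · intro i _
    simp [List.getD, List.getElem?_drop]

theorem OrderInvariant.map (hF : OrderInvariant F) {g : ℕ → ℕ}
    (h : ∀ a ∈ l, ∀ b ∈ l, (g a < g b ↔ a < b)) : onList F (l.map g) = onList F l := by
  rw [onList, onList, List.length_map]
  have := hF l.length (fun i => (l.map g).getD i 0) (fun i => l.getD i 0) 0 0 fun i hi j hj => by
    have hget : ∀ i, i < l.length → (l.map g).getD (0 + i) 0 = g (l.getD (0 + i) 0) ∧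
        l.getD (0 + i) 0 ∈ l := by
      intro i hi
      simp [List.getD, hi]
    rw [(hget i hi).1, (hget j hj).1]
    exact h _ (hget i hi).2 _ (hget j hj).2
  rwa [zero_add] at this

/-- `Nat.nth (· ∈ S)` and `Nat.count (· ∈ S)` are the inverse increasing bijections between ranks
and elements of `S`; relabelling by them preserves order-invariant values. -/
theorem sum_arrangements_eq_wordSum [AddCommMonoid R] (hF : OrderInvariant F) (S : Finset ℕ) :
    ∑ l ∈ arrangements S, onList F l = wordSum F S.card := by
  have hfin : {a | a ∈ S}.Finite := S.finite_toSet
  have hcard : hfin.toFinset.card = S.card := by congr 1; ext; simp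
  have hnth : ∀ i < S.card, Nat.nth (· ∈ S) i ∈ S := fun i hi =>
    Nat.nth_mem_of_lt_card hfin (by rwa [hcard])
  have hmono : ∀ i < S.card, ∀ j < S.card, (Nat.nth (· ∈ S) i < Nat.nth (· ∈ S) j ↔ i < j) := by
    intro i hi j hj
    exact (Nat.nth_strictMonoOn hfin).lt_iff_lt (by simpa [hcard] using hi)
      (by simpa [hcard] using hj)
  have hcount : ∀ i < S.card, Nat.count (· ∈ S) (Nat.nth (· ∈ S) i) = i := fun i hi =>
    Nat.count_nth fun hf => by convert hi
  have hcountlt : ∀ a ∈ S, Nat.count (· ∈ S) a < S.card := fun a ha => by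
    have := Nat.count_lt_card hfin ha
    rwa [hcard] at this
  refine (Finset.sum_bij' (fun l _ => l.map (Nat.nth (· ∈ S)))
    (fun l _ => l.map (Nat.count (· ∈ S)))
    ?_ ?_ ?_ ?_ ?_).symm
  · intro l hl
    have hmem : ∀ a ∈ l, a < S.card := fun a ha =>
      Finset.mem_range.1 ((mem_iff_of_mem_arrangements hl).1 ha)
    refine mem_arrangements.2 ⟨?_, ?_⟩
    · refine (mem_arrangements.1 hl).1.map_on fun a ha b hb hab => ?_
      rw [← hcount a (hmem a ha), hab, hcount b (hmem b hb)]
    · ext b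
      rw [List.mem_toFinset, List.mem_map]
      constructor
      · rintro ⟨a, ha, rfl⟩
        exact hnth a (hmem a ha)
      · intro hb
        exact ⟨Nat.count (· ∈ S) b, (mem_iff_of_mem_arrangements hl).2
          (Finset.mem_range.2 (hcountlt b hb)), Nat.nth_count hb⟩
  · intro l hl
    have hmem : ∀ a ∈ l, a ∈ S := fun a ha => (mem_iff_of_mem_arrangements hl).1 ha
    refine mem_arrangements.2 ⟨?_, ?_⟩
    · refine (mem_arrangements.1 hl).1.map_on fun a ha b hb hab => ?_
      rw [← Nat.nth_count (hmem a ha), hab, Nat.nth_count (hmem b hb)]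
    · ext b
      rw [List.mem_toFinset, List.mem_map, Finset.mem_range]
      constructor
      · rintro ⟨a, ha, rfl⟩
        exact hcountlt a (hmem a ha)
      · intro hb
        exact ⟨Nat.nth (· ∈ S) b, (mem_iff_of_mem_arrangements hl).2 (hnth b hb), hcount b hb⟩
  · intro l hl
    rw [List.map_map]
    conv_rhs => rw [← List.map_id l]
    exact List.map_congr_left fun a ha => hcount a
      (Finset.mem_range.1 ((mem_iff_of_mem_arrangements hl).1 ha))
  · intro l hl
    rw [List.map_map]
    conv_rhs => rw [← List.map_id l]
    exact List.map_congr_left fun a ha => Nat.nth_count (p := (· ∈ S))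
      ((mem_iff_of_mem_arrangements hl).1 ha)
  · intro l hl
    refine (hF.map fun a ha b hb => ?_).symm
    exact hmono a (Finset.mem_range.1 ((mem_iff_of_mem_arrangements hl).1 ha)) b
      (Finset.mem_range.1 ((mem_iff_of_mem_arrangements hl).1 hb))

end Arrangements

/-! ### Binomial convolutions and the recursion at the minimum -/

section Convolution

variable {R : Type*} [CommRing R] {k₁ k₂ : ℕ} {S : Finset ℕ} {F G : (ℕ → ℕ) → ℕ → ℕ → R}

/-- The binomial coefficient counts the possible sets of the first `k` letters; order invariance
makes all these sets contribute equally. -/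
theorem sum_arrangements_convolution (hF : OrderInvariant F) (hG : OrderInvariant G) (n : ℕ) :
    ∑ l ∈ arrangements (Finset.range n), ∑ k ∈ Finset.range (n + 1),
      onList F (l.take k) * onList G (l.drop k) =
    ∑ k ∈ Finset.range (n + 1), (n.choose k : R) * (wordSum F k * wordSum G (n - k)) := by
  rw [Finset.sum_comm]
  refine Finset.sum_congr rfl fun k hk => ?_
  rw [Finset.mem_range] at hk
  rw [sum_arrangements_take_drop (by rw [Finset.card_range]; omega)
    fun p q => onList F p * onList G q]
  have : ∀ T ∈ (Finset.range n).powersetCard k,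
      ∑ p ∈ arrangements T, ∑ q ∈ arrangements (Finset.range n \ T), onList F p * onList G q =
      wordSum F k * wordSum G (n - k) := by
    intro T hT
    rw [Finset.mem_powersetCard] at hT
    rw [← Finset.sum_mul_sum, sum_arrangements_eq_wordSum hF, sum_arrangements_eq_wordSum hG,
      Finset.card_sdiff_of_subset hT.1, hT.2, Finset.card_range]
  rw [Finset.sum_congr rfl this, Finset.sum_const, Finset.card_powersetCard, Finset.card_range,
    nsmul_eq_mul]

theorem sum_choose_wordSum_clusterWt_avoidWt (hk₁ : 2 ≤ k₁) (hk₂ : 2 ≤ k₂) (y : R) {n : ℕ}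
    (hn : n ≠ 0) :
    ∑ k ∈ Finset.range (n + 1), (n.choose k : R) *
      (wordSum (clusterWt k₁ k₂ y) k * wordSum (avoidWt k₁ k₂ 1 y) (n - k)) = 0 := by
  have hF := orderInvariant_clusterWt hk₁ hk₂ y
  have hG := orderInvariant_avoidWt hk₁ hk₂ 1 y
  rw [← sum_arrangements_convolution hF hG]
  refine Finset.sum_eq_zero fun l hl => ?_
  have hlen : l.length = n := by rw [length_of_mem_arrangements hl, Finset.card_range]
  rw [← sum_clusterWt_mul_avoidWt (y := y) (w := fun i => l.getD i 0) hk₁ hk₂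
    (Nat.pos_of_ne_zero hn), Finset.range_eq_Ico]
  refine Finset.sum_congr rfl fun k hk => ?_
  rw [Finset.mem_Icc] at hk
  rw [← hF.take (by omega), ← hG.drop (by omega), hlen]

/-- A summand supported on arrangements starting with their minimum. -/
theorem sum_arrangements_of_head_min {a : ℕ} (ha : a ∈ S) (hmin : ∀ b ∈ S, b ≠ a → a < b)
    {h : List ℕ → R} (hh : ∀ b q, h (b :: q) ≠ 0 → ∀ c ∈ q, b < c) :
    ∑ l ∈ arrangements S, h l = ∑ q ∈ arrangements (S.erase a), h (a :: q) := by
  rw [sum_arrangements_cons ⟨a, ha⟩]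
  refine Finset.sum_eq_single_of_mem a ha fun b hb hba => ?_
  refine Finset.sum_eq_zero fun q hq => ?_
  by_contra hne
  have h1 := hh b q hne a ((mem_iff_of_mem_arrangements hq).2 (Finset.mem_erase.2 ⟨hba.symm, ha⟩))
  exact h1.not_gt (hmin b hb hba)

/-- The restriction of a word functional to words starting with their minimum. -/
noncomputable def minHead (F : (ℕ → ℕ) → ℕ → ℕ → R) (w : ℕ → ℕ) (s e : ℕ) : R :=
  open Classical in if ∀ i, s < i → i < e → w s < w i then F w s e else 0

theorem OrderInvariant.minHead (hF : OrderInvariant F) : OrderInvariant (minHead F) := by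
  intro n w w' s s' hw
  have : (∀ i, s < i → i < s + n → w s < w i) ↔ ∀ i, s' < i → i < s' + n → w' s' < w' i := by
    constructor
    · intro h i hi hin
      have h1 := hw 0 (by omega) (i - s') (by omega)
      rw [show s' + (i - s') = i by omega] at h1
      exact h1.1 (h _ (by omega) (by omega))
    · intro h i hi hin
      have h1 := hw 0 (by omega) (i - s) (by omega)
      rw [show s + (i - s) = i by omega] at h1
      exact h1.2 (h _ (by omega) (by omega))
  rw [_root_.minHead, _root_.minHead, hF n w w' s s' hw]
  by_cases h : ∀ i, s < i → i < s + n → w s < w i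
  · rw [if_pos h, if_pos (this.1 h)]
  · rw [if_neg h, if_neg (mt this.2 h)]

theorem forall_getD_cons_iff {b : ℕ} {q : List ℕ} :
    (∀ i, 0 < i → i < (b :: q).length → (b :: q).getD 0 0 < (b :: q).getD i 0) ↔
      ∀ c ∈ q, b < c := by
  constructor
  · intro h c hc
    obtain ⟨i, hi, rfl⟩ := List.getElem_of_mem hc
    have := h (i + 1) (by omega) (by simpa using hi)
    simpa [List.getD, hi] using this
  · intro h i h0 hi
    obtain ⟨i, rfl⟩ := Nat.exists_eq_succ_of_ne_zero h0.ne'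
    have hi' : i < q.length := by simpa using hi
    have := h _ (List.getElem_mem hi')
    simpa [List.getD, hi'] using this

theorem sum_arrangements_cons_min (hF : OrderInvariant F) {a : ℕ} (ha : ∀ b ∈ S, a < b) :
    ∑ q ∈ arrangements S, onList F (a :: q) = wordSum (minHead F) (S.card + 1) := by
  have haS : a ∉ S := fun h => (ha a h).false
  rw [← Finset.card_insert_of_notMem haS, ← sum_arrangements_eq_wordSum hF.minHead,
    sum_arrangements_of_head_min (Finset.mem_insert_self a S), Finset.erase_insert haS]
  · refine Finset.sum_congr rfl fun q hq => ?_
    rw [onList, onList, minHead, if_pos]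
    exact forall_getD_cons_iff.2 fun c hc => ha c ((mem_iff_of_mem_arrangements hq).1 hc)
  · intro b hb hba
    exact ha b ((Finset.mem_insert.1 hb).resolve_left hba)
  · intro b q hne
    by_contra hcon
    rw [onList, minHead, if_neg fun h => hcon (forall_getD_cons_iff.1 h)] at hne
    exact hne rfl

theorem wordSum_zero (F : (ℕ → ℕ) → ℕ → ℕ → R) (w : ℕ → ℕ) (hF : OrderInvariant F) :
    wordSum F 0 = F w 0 0 := by
  rw [wordSum, Finset.range_zero, arrangements_empty, Finset.sum_singleton, onList]
  exact hF 0 _ _ 0 0 (by simp)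

/-- Arrangements are cut at the entry 0, with `T` the set of letters to its left. This is the
coefficient form of NM' = x·c·NM, and the second factor, c, is free of `x`. -/
theorem wordSum_avoidWt_succ (hk₁ : 2 ≤ k₁) (hk₂ : 2 ≤ k₂) (x y : R) (n : ℕ) :
    wordSum (avoidWt k₁ k₂ x y) (n + 1) = x * ∑ k ∈ Finset.range (n + 1), (n.choose k : R) *
      (wordSum (avoidWt k₁ k₂ x y) k * wordSum (minHead (avoidWt k₁ k₂ 1 y)) (n - k + 1)) := by
  have hF := orderInvariant_avoidWt hk₁ hk₂ x y
  have hG := orderInvariant_avoidWt hk₁ hk₂ 1 y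
  set S := (Finset.range (n + 1)).erase 0 with hS
  have hcard : S.card = n := by
    rw [hS, Finset.card_erase_of_mem (by simp), Finset.card_range, Nat.add_sub_cancel]
  have h0 : (0 : ℕ) ∉ S := Finset.notMem_erase _ _
  have hpos : ∀ b ∈ S, 0 < b := fun b hb => Nat.pos_of_ne_zero (Finset.ne_of_mem_erase hb)
  have hterm : ∀ T ∈ S.powerset, ∑ p ∈ arrangements T, ∑ q ∈ arrangements (S \ T),
      onList (avoidWt k₁ k₂ x y) (p ++ 0 :: q) =
      x * (wordSum (avoidWt k₁ k₂ x y) T.card *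
        wordSum (minHead (avoidWt k₁ k₂ 1 y)) (n - T.card + 1)) := by
    intro T hT
    rw [Finset.mem_powerset] at hT
    have hc : (S \ T).card = n - T.card := by rw [Finset.card_sdiff_of_subset hT, hcard]
    rw [← hc, ← sum_arrangements_cons_min hG fun b hb => hpos b (Finset.mem_sdiff.1 hb).1,
      ← sum_arrangements_eq_wordSum hF, Finset.sum_mul_sum, Finset.mul_sum]
    refine Finset.sum_congr rfl fun p hp => ?_
    rw [Finset.mul_sum]
    refine Finset.sum_congr rfl fun q hq => ?_
    have hlt : p.length < (p ++ 0 :: q).length := by simp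
    have ht := hF.take (l := p ++ 0 :: q) hlt.le
    have hd := hG.drop (l := p ++ 0 :: q) hlt.le
    rw [List.take_left] at ht
    rw [List.drop_left] at hd
    rw [onList, avoidWt_split (Nat.zero_le p.length) hlt, ht, hd]
    · ring
    · intro i _ hi hip
      have hm : (p ++ 0 :: q).getD p.length 0 = 0 := by simp [List.getD]
      rw [hm]
      rcases lt_or_gt_of_ne hip with h | h
      · rw [List.getD_append _ _ _ _ h]
        have : p.getD i 0 ∈ p := by simp [List.getD, h]
        exact hpos _ (hT ((mem_iff_of_mem_arrangements hp).1 this))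
      · rw [List.getD_append_right _ _ _ _ h.le]
        have hq' : i - p.length - 1 < q.length := by simp at hi; omega
        rw [show i - p.length = i - p.length - 1 + 1 by omega, List.getD_cons_succ]
        have : q.getD (i - p.length - 1) 0 ∈ q := by simp [List.getD, hq']
        exact hpos _ (Finset.mem_sdiff.1 ((mem_iff_of_mem_arrangements hq).1 this)).1
  have hins : wordSum (avoidWt k₁ k₂ x y) (n + 1) =
      ∑ l ∈ arrangements (insert 0 S), onList (avoidWt k₁ k₂ x y) l := by
    rw [wordSum, hS, Finset.insert_erase (by simp)]
  rw [hins, sum_arrangements_insert h0, Finset.sum_congr rfl hterm,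
    Finset.sum_powerset_apply_card (fun k => x * (wordSum (avoidWt k₁ k₂ x y) k *
        wordSum (minHead (avoidWt k₁ k₂ 1 y)) (n - k + 1))), hcard, Finset.mul_sum]
  refine Finset.sum_congr rfl fun k _ => ?_
  rw [nsmul_eq_mul]
  ring

end Convolution

/-! ### The recursion for sums of cluster weights -/

/-- The cluster weight of `l` with its first `j` entries removed, if these together with the
following entry are increasing. -/
noncomputable def peeledWt {R : Type*} [CommRing R] (k₁ k₂ : ℕ) (y : R) : ℕ → List ℕ → R
  | 0, l => onList (clusterWt k₁ k₂ y) l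
  | _ + 1, [] => 0
  | j + 1, a :: q => if q ≠ [] ∧ a < q.getD 0 0 then peeledWt k₁ k₂ y j q else 0

/-- The list `l` starts with an occurrence of the family `Γ_{k₁,k₂}`. -/
def ListOcc (k₁ k₂ : ℕ) (l : List ℕ) : Prop := Occ k₁ k₂ (fun i => l.getD i 0) 0 l.length

section Recursion

variable {R : Type*} [CommRing R] {k₁ k₂ : ℕ} {S : Finset ℕ} {y : R}

theorem onList_clusterWt_head_lt (hk₁ : 2 ≤ k₁) (hk₂ : 2 ≤ k₂) {b : ℕ} {q : List ℕ}
    (h : onList (clusterWt k₁ k₂ y) (b :: q) ≠ 0) : ∀ c ∈ q, b < c :=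
  forall_getD_cons_iff.1 (head_lt_of_clusterWt_ne_zero hk₁ hk₂ h)

theorem peeledWt_head_lt (hk₁ : 2 ≤ k₁) (hk₂ : 2 ≤ k₂) {j b : ℕ} {q : List ℕ}
    (h : peeledWt k₁ k₂ y j (b :: q) ≠ 0) : ∀ c ∈ q, b < c := by
  induction j generalizing b q with
  | zero => exact onList_clusterWt_head_lt hk₁ hk₂ h
  | succ j ih =>
    rw [peeledWt] at h
    split_ifs at h with hq
    · obtain ⟨c, q, rfl⟩ := List.exists_cons_of_ne_nil hq.1
      have hbc : b < c := hq.2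
      intro d hd
      rcases List.mem_cons.1 hd with rfl | hd
      · exact hbc
      · exact hbc.trans (ih h d hd)
    · exact absurd rfl h

theorem exists_forall_lt (hS : S.Nonempty) : ∃ a ∈ S, ∀ b ∈ S, b ≠ a → a < b :=
  ⟨S.min' hS, S.min'_mem hS, fun b hb hba => lt_of_le_of_ne (S.min'_le b hb) hba.symm⟩

/-- A nonzero weight forces the word to start with its minimum, and prepending the minimum always
creates an ascent; so each peeled letter just removes the smallest element of the set. -/
theorem sum_peeledWt (hk₁ : 2 ≤ k₁) (hk₂ : 2 ≤ k₂) (y : R) (j : ℕ) :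
    ∀ S : Finset ℕ, j < S.card → ∑ l ∈ arrangements S, peeledWt k₁ k₂ y j l =
      wordSum (clusterWt k₁ k₂ y) (S.card - j) := by
  induction j with
  | zero =>
    intro S _
    simp only [peeledWt, Nat.sub_zero]
    exact sum_arrangements_eq_wordSum (orderInvariant_clusterWt hk₁ hk₂ y) S
  | succ j ih =>
    intro S hS
    obtain ⟨a, ha, hmin⟩ := exists_forall_lt (Finset.card_pos.1 (by omega : 0 < S.card))
    have hcard := Finset.card_erase_of_mem ha
    rw [sum_arrangements_of_head_min ha hmin fun b q => peeledWt_head_lt hk₁ hk₂,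
      show S.card - (j + 1) = (S.erase a).card - j by omega, ← ih _ (by omega)]
    refine Finset.sum_congr rfl fun q hq => ?_
    have hlen := length_of_mem_arrangements hq
    obtain ⟨c, q, rfl⟩ := List.exists_cons_of_length_pos (l := q) (by omega)
    rw [peeledWt, if_pos]
    refine ⟨List.cons_ne_nil _ _, ?_⟩
    have hc := (mem_iff_of_mem_arrangements hq).1 (List.mem_cons_self)
    exact hmin c (Finset.mem_of_mem_erase hc) (Finset.ne_of_mem_erase hc)

theorem peeledWt_eq (j : ℕ) : ∀ l : List ℕ, j < l.length → peeledWt k₁ k₂ y j l =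
    if ∀ i < j, l.getD i 0 < l.getD (i + 1) 0 then onList (clusterWt k₁ k₂ y) (l.drop j)
      else 0 := by
  induction j with
  | zero => intro l _; simp [peeledWt]
  | succ j ih =>
    intro l hl
    obtain ⟨a, q, rfl⟩ := List.exists_cons_of_length_pos (l := l) (by omega)
    have hq : j < q.length := by simpa using hl
    have hne : q ≠ [] := by rintro rfl; simp at hq
    rw [peeledWt, ih q hq, List.drop_succ_cons]
    have : (∀ i < j + 1, (a :: q).getD i 0 < (a :: q).getD (i + 1) 0) ↔
        a < q.getD 0 0 ∧ ∀ i < j, q.getD i 0 < q.getD (i + 1) 0 := by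
      constructor
      · intro h
        exact ⟨h 0 (by omega), fun i hi => h (i + 1) (by omega)⟩
      · rintro ⟨h0, h⟩ i hi
        rcases i with _ | i
        · exact h0
        · exact h i (by omega)
    simp only [this, hne, ne_eq, not_false_eq_true, true_and]
    by_cases h1 : a < q.getD 0 0
    · simp only [h1, true_and, if_true]
    · simp only [h1, false_and, if_false]

/-- The cluster weight of a list in terms of the weights of its proper suffixes. -/
theorem onList_clusterWt_eq (hk₁ : 2 ≤ k₁) (hk₂ : 2 ≤ k₂) {l : List ℕ} (hl : 2 ≤ l.length) :
    onList (clusterWt k₁ k₂ y) l = (1 - y) * peeledWt k₁ k₂ y 1 l +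
      open Classical in if ListOcc k₁ k₂ l then
        -y * (onList (clusterWt k₁ k₂ y) (l.drop (max k₁ k₂)) +
          y * ∑ i ∈ Finset.Icc 1 (min k₁ k₂ - 1),
            onList (clusterWt k₁ k₂ y) (l.drop (max k₁ k₂ + i))) else 0 := by
  have hF := orderInvariant_clusterWt hk₁ hk₂ y
  have hM := le_max_left k₁ k₂
  rw [peeledWt_eq 1 l (by omega), ← hF.drop (by omega), onList]
  by_cases ho : ListOcc k₁ k₂ l
  · have hlen := ho.1
    -- In an initial occurrence the second run starts below position 1, so the word without its
    -- first letter does not start with its minimum. The peeled term can therefore be added without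
    -- excluding occurrences.
    have hzero : clusterWt k₁ k₂ y (fun i => l.getD i 0) 1 l.length = 0 := by
      by_contra hne
      have h1 := head_lt_of_clusterWt_ne_zero hk₁ hk₂ hne k₁ (by omega) (by omega)
      have h2 := ho.2.2.2.2
      simp only [zero_add] at h2
      exact h1.not_gt h2
    rw [if_pos ho, hzero, ite_self, mul_zero, zero_add, clusterWt_occ hk₁ ho, zero_add,
      hF.drop (by omega)]
    congr 3
    refine Finset.sum_congr rfl fun i hi => ?_
    rw [Finset.mem_Icc] at hi
    rw [zero_add, hF.drop (by omega)]
  · rw [if_neg ho, add_zero, clusterWt_not_occ (by omega) ho]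
    simp

/-- Lists whose initial occurrence is cut into its first entry `a`, the rest `p` of its first run,
and the word `q` starting with its second run. -/
theorem listOcc_cons_iff (hk₁ : 2 ≤ k₁) (hk₂ : 2 ≤ k₂) {a s : ℕ} {r : List ℕ}
    (hr : k₁ + k₂ ≤ r.length + 1) (hs : max k₁ k₂ ≤ s) (hs' : s < k₁ + k₂) :
    (open Classical in
      if ListOcc k₁ k₂ (a :: r) then onList (clusterWt k₁ k₂ y) ((a :: r).drop s) else 0) =
    if (r.take (k₁ - 1)).Pairwise (· < ·) ∧ a < (r.drop (k₁ - 1)).getD 0 0 ∧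
        ∀ b ∈ r.take (k₁ - 1), (r.drop (k₁ - 1)).getD 0 0 < b
      then peeledWt k₁ k₂ y (s - k₁) (r.drop (k₁ - 1)) else 0 := by
  have hF := orderInvariant_clusterWt hk₁ hk₂ y
  set w : ℕ → ℕ := fun i => (a :: r).getD i 0 with hw
  have hq : ∀ i, (r.drop (k₁ - 1)).getD i 0 = w (k₁ + i) := by
    intro i
    simp only [hw]
    rw [show k₁ + i = (k₁ - 1 + i) + 1 by omega, List.getD_cons_succ]
    simp [List.getD, List.getElem?_drop]
  have hdrop : (r.drop (k₁ - 1)).drop (s - k₁) = (a :: r).drop s := by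
    rw [List.drop_drop, show s = (s - 1) + 1 by omega, List.drop_succ_cons]
    congr 1
    omega
  have hlen : (r.drop (k₁ - 1)).length = r.length - (k₁ - 1) := List.length_drop
  rw [peeledWt_eq _ _ (by omega), hdrop]
  by_cases hzero : onList (clusterWt k₁ k₂ y) ((a :: r).drop s) = 0
  · simp [hzero]
  rw [← ite_and]
  have of_iff : ∀ {P Q : Prop} {_ : Decidable P} {_ : Decidable Q} {c : R}, (P ↔ Q) →
      (if P then c else 0) = if Q then c else 0 := fun h => by simp only [h]
  refine of_iff ?_
  -- The right side checks the second run only up to position `s`. The later ascents are forced by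
  -- the nonzero weight of the suffix, whose first `k₁ - 1` steps reach the end of the occurrence
  -- because `s ≥ k₂`.
  have hasc : ∀ i, i + 1 < k₁ → s + i + 1 < (a :: r).length → w (s + i) < w (s + i + 1) := by
    rw [← hF.drop (by simp only [List.length_cons]; omega)] at hzero
    exact fun i hi hi' => ascending_of_clusterWt_ne_zero hzero hi hi'
  rw [List.length_cons] at hasc
  have hp : ∀ i, i + 1 < k₁ → ∃ h : i < (r.take (k₁ - 1)).length,
      (r.take (k₁ - 1))[i] = w (i + 1) := by
    intro i hi
    have : i < (r.take (k₁ - 1)).length := by rw [List.length_take]; omega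
    refine ⟨this, ?_⟩
    have h1 : i < r.length := by omega
    simp [hw, List.getD, h1]
  have hplen : (r.take (k₁ - 1)).length = k₁ - 1 := by rw [List.length_take]; omega
  simp only [hq, add_zero, List.pairwise_iff_getElem, hplen]
  constructor
  · intro ho
    refine ⟨⟨fun i j hi hj hij => ?_, ?_, fun b hb => ?_⟩, fun i hi => ?_⟩
    · rw [(hp i (by omega)).2, (hp j (by omega)).2]
      have := ho.left_lt (i := i + 1) (j := j + 1) (by omega) (by omega)
      simpa only [zero_add] using this
    · have := ho.2.2.2.1
      rwa [zero_add] at this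
    · obtain ⟨i, hi, rfl⟩ := List.getElem_of_mem hb
      rw [(hp i (by omega)).2]
      have h1 := ho.second_le (j := i + 1) (by omega) (by omega)
      have h2 := ho.2.2.2.2
      simp only [zero_add] at h1 h2
      exact h2.trans_le h1
    · have := ho.2.2.1 (k₁ + i) (by omega) (by omega)
      simpa only [zero_add, add_assoc] using this
  · rintro ⟨⟨h1, h2, h3⟩, h4⟩
    have h5 : w k₁ < w 1 := by
      have := h3 _ (List.getElem_mem (hp 0 (by omega)).1)
      rwa [(hp 0 (by omega)).2] at this
    refine ⟨by simp only [List.length_cons]; omega, fun i hi => ?_, fun i hi hi' => ?_, ?_, ?_⟩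
    · rw [zero_add]
      rcases i with _ | i
      · exact h2.trans h5
      · have := h1 i (i + 1) (by omega) (by omega) (by omega)
        rwa [(hp i (by omega)).2, (hp (i + 1) (by omega)).2] at this
    · rw [zero_add]
      rcases lt_or_ge i s with h | h
      · have := h4 (i - k₁) (by omega)
        rwa [show k₁ + (i - k₁) = i by omega, show k₁ + (i - k₁ + 1) = i + 1 by omega] at this
      · have := hasc (i - s) (by omega) (by omega)
        rwa [show s + (i - s) = i by omega] at this
    · rw [zero_add]; exact h2
    · rw [zero_add, zero_add]; exact h5

theorem sum_sorted_arrangements (T : Finset ℕ) (c : R) :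
    ∑ p ∈ arrangements T, (if p.Pairwise (· < ·) then c else 0) = c := by
  have hmem : T.sort (· ≤ ·) ∈ arrangements T :=
    mem_arrangements.2 ⟨T.sort_nodup (· ≤ ·), T.sort_toFinset (· ≤ ·)⟩
  have hsort : (T.sort (· ≤ ·)).Pairwise (· < ·) := T.sortedLT_sort.pairwise
  rw [Finset.sum_eq_single_of_mem _ hmem, if_pos hsort]
  intro p hp hne
  rw [if_neg]
  intro hpw
  refine hne (List.Perm.eq_of_pairwise (le := (· < ·)) ?_ hpw hsort ?_)
  · intro a b _ _ h1 h2
    exact absurd h1 h2.not_gt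
  · refine (List.perm_ext_iff_of_nodup (mem_arrangements.1 hp).1 (mem_arrangements.1 hmem).1).2 ?_
    intro a
    rw [mem_iff_of_mem_arrangements hp, mem_iff_of_mem_arrangements hmem]

/-- Arrangements starting with an occurrence, weighted by the cluster weight of a proper suffix
that overlaps the occurrence. -/
theorem sum_listOcc (hk₁ : 2 ≤ k₁) (hk₂ : 2 ≤ k₂) (y : R) {s : ℕ} (hs : max k₁ k₂ ≤ s)
    (hs' : s < k₁ + k₂) (hS : k₁ + k₂ ≤ S.card) :
    (∑ l ∈ arrangements S, open Classical in
      if ListOcc k₁ k₂ l then onList (clusterWt k₁ k₂ y) (l.drop s) else 0) =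
    ((S.card - 2).choose (k₁ - 1) : R) * wordSum (clusterWt k₁ k₂ y) (S.card - s) := by
  have hks := (le_max_left k₁ k₂).trans hs
  -- `a` and `c` are the two smallest elements: `a` heads the word and `c` must head the second run.
  obtain ⟨a, ha, hmin⟩ := exists_forall_lt (Finset.card_pos.1 (by omega : 0 < S.card))
  have hcard := Finset.card_erase_of_mem ha
  obtain ⟨c, hc, hcmin⟩ := exists_forall_lt (Finset.card_pos.1 (by omega : 0 < (S.erase a).card))
  have hcard' := Finset.card_erase_of_mem hc
  have hac : a < c := hmin c (Finset.mem_of_mem_erase hc) (Finset.ne_of_mem_erase hc)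
  rw [sum_arrangements_of_head_min ha hmin]
  swap
  · intro b q hne d hd
    by_cases ho : ListOcc k₁ k₂ (b :: q)
    · rw [if_pos ho, ← (orderInvariant_clusterWt hk₁ hk₂ y).drop
        (by have := ho.1; omega)] at hne
      have hlen := ho.1
      refine (forall_getD_cons_iff (b := b)).1 (fun i h0 hi => ?_) d hd
      rcases lt_or_ge i (k₁ + k₂) with h | h
      · have := ho.head_lt h0 h
        rwa [zero_add] at this
      · have h1 := ho.head_lt (j := s) (by omega) hs'
        rw [zero_add] at h1
        exact h1.trans (head_lt_of_clusterWt_ne_zero hk₁ hk₂ hne i (by omega) hi)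
    · rw [if_neg ho] at hne
      exact absurd rfl hne
  have hcongr : ∀ r ∈ arrangements (S.erase a), _ := fun r hr =>
    listOcc_cons_iff (y := y) hk₁ hk₂ (a := a) (r := r)
      (by rw [length_of_mem_arrangements hr]; omega) hs hs'
  rw [Finset.sum_congr rfl hcongr, sum_arrangements_take_drop (k := k₁ - 1) (by omega)
    fun p q => if p.Pairwise (· < ·) ∧ a < q.getD 0 0 ∧ ∀ b ∈ p, q.getD 0 0 < b
      then peeledWt k₁ k₂ y (s - k₁) q else 0]
  -- `T` holds the entries of the first run after `a`, in their unique increasing order. It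
  -- contributes exactly when it avoids `c`, which leaves `S.card - 2` elements to choose from.
  have hterm : ∀ T ∈ (S.erase a).powersetCard (k₁ - 1),
      ∑ p ∈ arrangements T, ∑ q ∈ arrangements (S.erase a \ T),
        (if p.Pairwise (· < ·) ∧ a < q.getD 0 0 ∧ ∀ b ∈ p, q.getD 0 0 < b
          then peeledWt k₁ k₂ y (s - k₁) q else 0) =
      if c ∉ T then wordSum (clusterWt k₁ k₂ y) (S.card - s) else 0 := by
    intro T hT
    rw [Finset.mem_powersetCard] at hT
    have hTc : (S.erase a \ T).card = S.card - k₁ := by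
      rw [Finset.card_sdiff_of_subset hT.1]; omega
    by_cases hcT : c ∈ T
    · rw [if_neg (not_not.2 hcT)]
      refine Finset.sum_eq_zero fun p hp => Finset.sum_eq_zero fun q hq => if_neg ?_
      rintro ⟨-, -, h⟩
      have h1 := h c ((mem_iff_of_mem_arrangements hp).2 hcT)
      have hlen := length_of_mem_arrangements hq
      obtain ⟨d, q, rfl⟩ := List.exists_cons_of_length_pos (l := q) (by omega)
      have hd := Finset.mem_sdiff.1 ((mem_iff_of_mem_arrangements hq).1 List.mem_cons_self)
      have hdc : d ≠ c := fun h => hd.2 (h ▸ hcT)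
      exact (hcmin d hd.1 hdc).not_gt h1
    · rw [if_pos hcT]
      have hpq : ∀ p ∈ arrangements T, ∀ q ∈ arrangements (S.erase a \ T),
          (if p.Pairwise (· < ·) ∧ a < q.getD 0 0 ∧ ∀ b ∈ p, q.getD 0 0 < b
            then peeledWt k₁ k₂ y (s - k₁) q else 0) =
          if p.Pairwise (· < ·) then peeledWt k₁ k₂ y (s - k₁) q else 0 := by
        intro p hp q hq
        by_cases hzero : peeledWt k₁ k₂ y (s - k₁) q = 0
        · simp [hzero]
        refine if_congr (and_iff_left ?_) rfl rfl
        have hlen := length_of_mem_arrangements hq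
        obtain ⟨d, q, rfl⟩ := List.exists_cons_of_length_pos (l := q) (by omega)
        have hcq := (mem_iff_of_mem_arrangements hq).2 (Finset.mem_sdiff.2 ⟨hc, hcT⟩)
        have hd := Finset.mem_sdiff.1 ((mem_iff_of_mem_arrangements hq).1 List.mem_cons_self)
        -- A nonzero peeled weight puts the minimum of the remaining letters first, and `c` is among
        -- them; the two inequalities on the head of `q` are then automatic.
        have hdc : d = c := by
          rcases List.mem_cons.1 hcq with h | h
          · exact h.symm
          · by_contra hne
            exact (hcmin d hd.1 hne).not_gt (peeledWt_head_lt hk₁ hk₂ hzero c h)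
        subst hdc
        refine ⟨hac, fun b hb => ?_⟩
        have hbT := (mem_iff_of_mem_arrangements hp).1 hb
        exact hcmin b (hT.1 hbT) fun h => hcT (h ▸ hbT)
      rw [Finset.sum_congr rfl fun p hp => Finset.sum_congr rfl (hpq p hp), Finset.sum_comm]
      simp only [sum_sorted_arrangements]
      rw [sum_peeledWt hk₁ hk₂ y _ _ (by omega), hTc]
      congr 1
      omega
  have hfilter : ((S.erase a).powersetCard (k₁ - 1)).filter (fun T => c ∉ T) =
      ((S.erase a).erase c).powersetCard (k₁ - 1) := by
    ext T
    simp only [Finset.mem_filter, Finset.mem_powersetCard, Finset.subset_erase]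
    tauto
  rw [Finset.sum_congr rfl hterm, ← Finset.sum_filter, Finset.sum_const, hfilter,
    Finset.card_powersetCard, hcard', hcard, nsmul_eq_mul]
  congr 2

theorem wordSum_clusterWt_of_lt (hk₁ : 2 ≤ k₁) (hk₂ : 2 ≤ k₂) (y : R) {n : ℕ} (hn : 2 ≤ n)
    (hW : n < k₁ + k₂) :
    wordSum (clusterWt k₁ k₂ y) n = (1 - y) * wordSum (clusterWt k₁ k₂ y) (n - 1) := by
  have h1 := sum_peeledWt hk₁ hk₂ y 1 (Finset.range n) (by rw [Finset.card_range]; omega)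
  rw [Finset.card_range] at h1
  rw [← h1, wordSum, Finset.mul_sum]
  refine Finset.sum_congr rfl fun l hl => ?_
  have hlen := length_of_mem_arrangements hl
  rw [Finset.card_range] at hlen
  rw [onList_clusterWt_eq hk₁ hk₂ (by omega), if_neg, add_zero]
  intro ho
  have := ho.1
  omega

theorem wordSum_clusterWt_of_le (hk₁ : 2 ≤ k₁) (hk₂ : 2 ≤ k₂) (y : R) {n : ℕ}
    (hW : k₁ + k₂ ≤ n) :
    wordSum (clusterWt k₁ k₂ y) n = (1 - y) * wordSum (clusterWt k₁ k₂ y) (n - 1) -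
      y * ((n - 2).choose (k₁ - 1) : R) * (wordSum (clusterWt k₁ k₂ y) (n - max k₁ k₂) +
        y * ∑ i ∈ Finset.Icc 1 (min k₁ k₂ - 1),
          wordSum (clusterWt k₁ k₂ y) (n - (max k₁ k₂ + i))) := by
  classical
  have h1 := sum_peeledWt hk₁ hk₂ y 1 (Finset.range n) (by rw [Finset.card_range]; omega)
  have hcard : (Finset.range n).card = n := Finset.card_range n
  have h2 : ∀ s, max k₁ k₂ ≤ s → s < k₁ + k₂ → _ := fun s hs hs' =>
    sum_listOcc (S := Finset.range n) hk₁ hk₂ y hs hs' (by rwa [hcard])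
  rw [hcard] at h1 h2
  have h3 : ∀ l ∈ arrangements (Finset.range n), onList (clusterWt k₁ k₂ y) l =
      (1 - y) * peeledWt k₁ k₂ y 1 l -
      y * ((if ListOcc k₁ k₂ l then onList (clusterWt k₁ k₂ y) (l.drop (max k₁ k₂)) else 0) +
        y * ∑ i ∈ Finset.Icc 1 (min k₁ k₂ - 1), if ListOcc k₁ k₂ l then
          onList (clusterWt k₁ k₂ y) (l.drop (max k₁ k₂ + i)) else 0) := by
    intro l hl
    have hlen := length_of_mem_arrangements hl
    rw [hcard] at hlen
    rw [onList_clusterWt_eq hk₁ hk₂ (by omega)]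
    split_ifs
    · ring
    · simp
  rw [← h1, wordSum, Finset.sum_congr rfl h3, Finset.sum_sub_distrib, ← Finset.mul_sum,
    ← Finset.mul_sum, Finset.sum_add_distrib, ← Finset.mul_sum, Finset.sum_comm,
    h2 _ le_rfl (by omega)]
  have h4 : ∀ i ∈ Finset.Icc 1 (min k₁ k₂ - 1), _ := fun i hi =>
    h2 (max k₁ k₂ + i) (by omega) (by rw [Finset.mem_Icc] at hi; omega)
  rw [Finset.sum_congr rfl h4, ← Finset.mul_sum]
  ring

end Recursion

/-! ### Initial values and the polynomial recursion -/

section SmallWords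

variable {R : Type*} [CommRing R] {k₁ k₂ : ℕ} {y : R}

theorem wordSum_clusterWt_zero (hk₁ : 2 ≤ k₁) (hk₂ : 2 ≤ k₂) (y : R) :
    wordSum (clusterWt k₁ k₂ y) 0 = 1 := by
  rw [wordSum_zero _ (fun _ => 0) (orderInvariant_clusterWt hk₁ hk₂ y), clusterWt_nil le_rfl]

theorem wordSum_clusterWt_one (y : R) :
    wordSum (clusterWt k₁ k₂ y) 1 = -y := by
  rw [wordSum, sum_arrangements_cons (by simp), Finset.range_one, Finset.sum_singleton,
    Finset.erase_singleton, arrangements_empty, Finset.sum_singleton]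
  exact clusterWt_single

theorem wordSum_clusterWt_eq_ascendingWt (hk₁ : 2 ≤ k₁) (hk₂ : 2 ≤ k₂) (y : R) {j : ℕ}
    (hj : j < k₁ + k₂) : wordSum (clusterWt k₁ k₂ y) j = ascendingWt y j := by
  induction j with
  | zero => rw [wordSum_clusterWt_zero hk₁ hk₂]; rfl
  | succ j ih =>
    rcases j with _ | j
    · rw [wordSum_clusterWt_one]; simp [ascendingWt]
    · rw [wordSum_clusterWt_of_lt hk₁ hk₂ y (by omega) hj, ascendingWt_succ_succ, ← ih (by omega)]
      rfl

theorem map_avoidWt {R' : Type*} [CommRing R'] (f : R →+* R') (x y : R) (w : ℕ → ℕ) (s e : ℕ) :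
    f (avoidWt k₁ k₂ x y w s e) = avoidWt k₁ k₂ (f x) (f y) w s e := by
  rw [avoidWt, avoidWt]
  split_ifs <;> simp

end SmallWords

section ClusterPolynomial

variable {k₁ k₂ : ℕ}

open Polynomial in
-- From `k₁ + k₂` on this is the summed recursion of `clusterWt`. Below, the true recursion has no
-- second term, so the second term must vanish: by negative indices, by the binomial coefficient, or
-- by `ascendingWt_add_sum`.
theorem clusterPolynomial_recursion (hk₁ : 2 ≤ k₁) (hk₂ : 2 ≤ k₂) {U : ℕ → Polynomial ℤ}
    (hU : U = wordSum (clusterWt k₁ k₂ (X : ℤ[X]))) {n : ℕ} (hn : 2 ≤ n)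
    (hne : ¬ (k₁ < k₂ ∧ n = k₂)) :
    U n = (1 - X) * U (n - 1) - X * (Nat.choose (n - 2) (k₁ - 1) : ℤ[X]) *
      (back U n (max k₁ k₂) +
        X * ∑ i ∈ Finset.Icc 1 (min k₁ k₂ - 1), back U n (max k₁ k₂ + i)) := by
  have hMm : max k₁ k₂ + min k₁ k₂ = k₁ + k₂ := by omega
  rcases lt_or_ge n (k₁ + k₂) with hW | hW
  · have hzero : (Nat.choose (n - 2) (k₁ - 1) : ℤ[X]) *
      (back U n (max k₁ k₂) +
        X * ∑ i ∈ Finset.Icc 1 (min k₁ k₂ - 1), back U n (max k₁ k₂ + i)) = 0 := by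
      rcases lt_trichotomy n (max k₁ k₂) with h | h | h
      · rw [back, if_neg (by omega), Finset.sum_eq_zero]
        · simp
        · intro i _
          rw [back, if_neg (by omega)]
      -- At `n = max k₁ k₂` the excluded case leaves `n = k₁`, and the binomial coefficient is `k₁ -
      -- 2` over `k₁ - 1`.
      · rw [Nat.choose_eq_zero_of_lt (by omega), Nat.cast_zero, zero_mul]
      · obtain ⟨j, rfl⟩ := Nat.exists_eq_add_of_lt h
        have hs : Finset.Icc 1 (j + 1) ⊆ Finset.Icc 1 (min k₁ k₂ - 1) :=
          Finset.Icc_subset_Icc le_rfl (by omega)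
        rw [← Finset.sum_subset hs, back, if_pos (by omega)]
        · have hterm : ∀ i ∈ Finset.Icc 1 (j + 1),
              back U (max k₁ k₂ + j + 1) (max k₁ k₂ + i) = ascendingWt X (j + 1 - i) := by
            intro i hi
            rw [Finset.mem_Icc] at hi
            rw [back, if_pos (by omega), hU,
              wordSum_clusterWt_eq_ascendingWt hk₁ hk₂ _ (by omega)]
            congr 1
            omega
          rw [Finset.sum_congr rfl hterm, hU,
            wordSum_clusterWt_eq_ascendingWt hk₁ hk₂ _ (by omega),
            show max k₁ k₂ + j + 1 - max k₁ k₂ = j + 1 by omega, ascendingWt_add_sum, mul_zero]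
        · intro i hi' hi
          rw [Finset.mem_Icc] at hi hi'
          rw [back, if_neg (by omega)]
    rw [mul_assoc, hzero, mul_zero, sub_zero, hU]
    exact wordSum_clusterWt_of_lt hk₁ hk₂ X hn hW
  · have hterm : ∀ i ∈ Finset.Icc 1 (min k₁ k₂ - 1), back U n (max k₁ k₂ + i) =
        U (n - (max k₁ k₂ + i)) := by
      intro i hi
      rw [Finset.mem_Icc] at hi
      rw [back, if_pos (by omega)]
    rw [Finset.sum_congr rfl hterm, back, if_pos (by omega), hU]
    exact wordSum_clusterWt_of_le hk₁ hk₂ X hW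

end ClusterPolynomial

/-! ### Exponential generating functions and formal powers -/

section ExponentialGeneratingFunctions

theorem coeff_expGen_mul (a b : ℕ → QYX) (n : ℕ) :
    PowerSeries.coeff n (expGen a * expGen b) =
      ((n ! : ℚ)⁻¹) • ∑ k ∈ Finset.range (n + 1), (n.choose k : QYX) * (a k * b (n - k)) := by
  rw [PowerSeries.coeff_mul, Finset.Nat.sum_antidiagonal_eq_sum_range_succ_mk, Finset.smul_sum]
  refine Finset.sum_congr rfl fun k hk => ?_
  have hkn : k ≤ n := Nat.lt_succ_iff.1 (Finset.mem_range.1 hk)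
  rw [expGen, expGen, PowerSeries.coeff_mk, PowerSeries.coeff_mk, smul_mul_smul_comm,
    ← nsmul_eq_mul, ← Nat.cast_smul_eq_nsmul ℚ, smul_smul, Nat.cast_choose ℚ hkn]
  congr 1
  have h1 : (n ! : ℚ) ≠ 0 := by exact_mod_cast n.factorial_ne_zero
  have h2 : (k ! : ℚ) ≠ 0 := by exact_mod_cast k.factorial_ne_zero
  have h3 : ((n - k)! : ℚ) ≠ 0 := by exact_mod_cast (n - k).factorial_ne_zero
  field_simp

theorem expGen_mul (a b : ℕ → QYX) : expGen a * expGen b =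
    expGen fun n => ∑ k ∈ Finset.range (n + 1), (n.choose k : QYX) * (a k * b (n - k)) := by
  ext1 n
  rw [coeff_expGen_mul, expGen, PowerSeries.coeff_mk]

theorem derivative_expGen (a : ℕ → QYX) :
    PowerSeries.derivative QYX (expGen a) = expGen fun n => a (n + 1) := by
  ext1 n
  rw [PowerSeries.coeff_derivative, expGen, expGen, PowerSeries.coeff_mk, PowerSeries.coeff_mk]
  have h : ((n : QYX) + 1) = algebraMap ℚ QYX ((n : ℚ) + 1) := by simp
  rw [h, mul_comm, ← Algebra.smul_def, smul_smul, Nat.factorial_succ]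
  congr 1
  have h1 : (n ! : ℚ) ≠ 0 := by exact_mod_cast n.factorial_ne_zero
  have h2 : (n : ℚ) + 1 ≠ 0 := by positivity
  push_cast
  field_simp

theorem C_mul_expGen (r : QYX) (a : ℕ → QYX) :
    PowerSeries.C r * expGen a = expGen fun n => r * a n := by
  ext1 n
  rw [PowerSeries.coeff_C_mul, expGen, expGen, PowerSeries.coeff_mk, PowerSeries.coeff_mk,
    mul_smul_comm]

theorem constantCoeff_expGen (a : ℕ → QYX) : PowerSeries.constantCoeff (expGen a) = a 0 := by
  rw [← PowerSeries.coeff_zero_eq_constantCoeff_apply, expGen, PowerSeries.coeff_mk]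
  simp

end ExponentialGeneratingFunctions

section FormalPower

open PowerSeries

variable {K : Type*} [CommRing K]

theorem one_add_X_mul_derivative_binomialSeries [BinomialRing K] (r : K) :
    (1 + X) * derivative K (binomialSeries K r) = C r * binomialSeries K r := by
  ext1 n
  have hch : ∀ n : ℕ, Ring.choose r (n + 1) * ((n : K) + 1) =
      Ring.choose r n * (r - (n : K)) := by
    intro n
    have := Ring.choose_smul_choose r (Nat.le_succ n)
    rw [Nat.succ_eq_add_one, Nat.add_sub_cancel_left, Ring.choose_one_right,
      Nat.choose_succ_self_right, nsmul_eq_mul] at this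
    rw [← this]
    push_cast
    ring
  have hb : ∀ n, coeff n (binomialSeries K r) = Ring.choose r n := by
    intro n
    rw [binomialSeries_coeff, smul_eq_mul, mul_one]
  rw [add_mul, one_mul, map_add, coeff_C_mul, coeff_derivative, hb, hb, hch]
  rcases n with _ | n
  · rw [coeff_zero_X_mul]
    push_cast
    ring
  · rw [coeff_succ_X_mul, coeff_derivative, hb]
    push_cast
    ring

/-- The quotient of two solutions has derivative zero; without additive torsion it is its constant
term 1. -/
theorem eq_of_derivative_eq_mul [IsAddTorsionFree K] {A B c : PowerSeries K}
    (hA : derivative K A = c * A) (hB : derivative K B = c * B) (hA0 : constantCoeff A = 1) (hB0 : constantCoeff B = 1) :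
    A = B := by
  have hinv : A * invOfUnit A 1 = 1 := mul_invOfUnit A 1 (by rw [hA0]; rfl)
  set I := invOfUnit A 1
  have hI0 : constantCoeff I = 1 := by
    have := congrArg constantCoeff hinv
    rwa [map_mul, hA0, one_mul, map_one] at this
  have hI : derivative K I = -c * I := by
    have h1 := congrArg (derivative K) hinv
    rw [Derivation.leibniz, hA, smul_eq_mul, smul_eq_mul, Derivation.map_one_eq_zero] at h1
    have h2 : I * (A * derivative K I + I * (c * A)) = 0 := by rw [h1, mul_zero]
    linear_combination h2 - (derivative K I + c * I) * hinv
  have hBI : B * I = 1 := by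
    refine derivative.ext ?_ ?_
    · rw [Derivation.leibniz, hB, hI, smul_eq_mul, smul_eq_mul, Derivation.map_one_eq_zero]
      ring
    · rw [map_mul, hB0, hI0, map_one, one_mul]
  linear_combination B * hinv - A * hBI

theorem constantCoeff_subst_binomialSeries [BinomialRing K] {A : PowerSeries K}
    (hA0 : constantCoeff A = 1) (r : K) :
    constantCoeff (subst (A - 1) (binomialSeries K r) : PowerSeries K) = 1 := by
  have hg0 : constantCoeff (A - 1) = 0 := by rw [map_sub, hA0, map_one, sub_self]
  have hg : HasSubst (A - 1) := HasSubst.of_constantCoeff_zero' hg0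
  have h := constantCoeff_subst_eq_zero hg0 (binomialSeries K r - 1)
    (by rw [map_sub, binomialSeries_constantCoeff, map_one, sub_self])
  rw [← coe_substAlgHom hg, map_sub, map_one, coe_substAlgHom hg] at h
  change constantCoeff (subst (A - 1) (binomialSeries K r) - 1) = 0 at h
  rwa [map_sub, map_one, sub_eq_zero] at h

/-- The chain rule gives the factor `c * A`, and substituting `A - 1` into the differential equation
of the binomial series absorbs this `A`, since `1 + X` becomes `A`. -/
theorem derivative_subst_binomialSeries [BinomialRing K] {A c : PowerSeries K}
    (hA : derivative K A = c * A)
    (hA0 : constantCoeff A = 1) (r : K) :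
    derivative K (subst (A - 1) (binomialSeries K r)) =
      C r * c * subst (A - 1) (binomialSeries K r) := by
  have hg0 : constantCoeff (A - 1) = 0 := by rw [map_sub, hA0, map_one, sub_self]
  have hg : HasSubst (A - 1) := HasSubst.of_constantCoeff_zero' hg0
  have h := congrArg (substAlgHom (R := K) hg) (one_add_X_mul_derivative_binomialSeries r)
  have hC : substAlgHom (R := K) hg (C r) = C r := (substAlgHom (R := K) hg).commutes r
  rw [map_mul, map_mul, map_add, map_one, hC, substAlgHom_X, coe_substAlgHom] at h
  have hd : derivative K (subst (A - 1) (binomialSeries K r)) =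
      subst (A - 1) (derivative K (binomialSeries K r)) * (c * A) := by
    rw [derivative_subst hg, map_sub, Derivation.map_one_eq_zero, sub_zero, hA]
  rw [hd]
  change (1 + (A - 1)) * subst (A - 1) (derivative K (binomialSeries K r)) =
    C r * subst (A - 1) (binomialSeries K r) at h
  linear_combination c * h

end FormalPower

section GeneratingFunction

variable {k₁ k₂ : ℕ}

theorem expGen_avoidWt_eq_formalPow (hk₁ : 2 ≤ k₁) (hk₂ : 2 ≤ k₂) :
    expGen (wordSum (avoidWt k₁ k₂ varX varY)) =
      formalPow (recip (expGen fun n => inY (wordSum (clusterWt k₁ k₂ Polynomial.X) n))) varX := by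
  set A := expGen (wordSum (avoidWt k₁ k₂ 1 varY)) with hA
  set c := expGen fun n => wordSum (minHead (avoidWt k₁ k₂ 1 varY)) (n + 1) with hc
  have hder : ∀ x : QYX, PowerSeries.derivative QYX (expGen (wordSum (avoidWt k₁ k₂ x varY))) =
      PowerSeries.C x * c * expGen (wordSum (avoidWt k₁ k₂ x varY)) := by
    intro x
    rw [derivative_expGen, mul_assoc, mul_comm c, hc, expGen_mul, C_mul_expGen]
    congr 1
    ext1 n
    exact wordSum_avoidWt_succ hk₁ hk₂ x varY n
  have hconst : ∀ x : QYX,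
      PowerSeries.constantCoeff (expGen (wordSum (avoidWt k₁ k₂ x varY))) = 1 := by
    intro x
    rw [constantCoeff_expGen, wordSum_zero _ (fun _ => 0) (orderInvariant_avoidWt hk₁ hk₂ x varY),
      avoidWt_nil le_rfl]
  -- At `x = 1` the weights lie in the image of ℤ[y], so the convolution identity is proved over
  -- ℤ[y] and transported along `f`.
  let f : Polynomial ℤ →+* QYX :=
    (Polynomial.C : Polynomial ℚ →+* QYX).comp (Polynomial.mapRingHom (Int.castRingHom ℚ))
  have hf : ∀ p, inY p = f p := fun p => rfl
  have hfX : f Polynomial.X = varY := by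
    simp [f, varY]
  have hV : ∀ n, wordSum (avoidWt k₁ k₂ 1 varY) n =
      f (wordSum (avoidWt k₁ k₂ 1 (Polynomial.X : Polynomial ℤ)) n) := by
    intro n
    rw [wordSum, wordSum, map_sum]
    refine Finset.sum_congr rfl fun l _ => ?_
    rw [onList, onList, map_avoidWt, map_one, hfX]
  have hUA : (expGen fun n => inY (wordSum (clusterWt k₁ k₂ Polynomial.X) n)) * A = 1 := by
    rw [hA, expGen_mul]
    ext1 n
    rw [expGen, PowerSeries.coeff_mk, PowerSeries.coeff_one]
    simp only [hf, hV, ← map_mul, ← map_natCast f, ← map_sum]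
    by_cases hn : n = 0
    · subst hn
      have h0 : wordSum (avoidWt k₁ k₂ 1 (Polynomial.X : Polynomial ℤ)) 0 = 1 := by
        rw [wordSum_zero _ (fun _ => 0) (orderInvariant_avoidWt hk₁ hk₂ 1 _), avoidWt_nil le_rfl]
      simp [wordSum_clusterWt_zero hk₁ hk₂, h0]
    · rw [sum_choose_wordSum_clusterWt_avoidWt hk₁ hk₂ Polynomial.X hn, map_zero, smul_zero,
        if_neg hn]
  have hrecip : recip (expGen fun n => inY (wordSum (clusterWt k₁ k₂ Polynomial.X) n)) = A := by
    have h0 : PowerSeries.constantCoeff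
        (expGen fun n => inY (wordSum (clusterWt k₁ k₂ Polynomial.X) n)) = 1 := by
      rw [constantCoeff_expGen, wordSum_clusterWt_zero hk₁ hk₂, hf, map_one]
    have h1 := PowerSeries.mul_invOfUnit
      (expGen fun n => inY (wordSum (clusterWt k₁ k₂ Polynomial.X) n)) 1 (by rw [h0]; rfl)
    rw [recip]
    linear_combination A * h1 - PowerSeries.invOfUnit
      (expGen fun n => inY (wordSum (clusterWt k₁ k₂ Polynomial.X) n)) 1 * hUA
  rw [hrecip]
  have hA' : PowerSeries.derivative QYX A = c * A := by
    have := hder 1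
    rwa [map_one, one_mul] at this
  exact eq_of_derivative_eq_mul (hder varX) (derivative_subst_binomialSeries hA' (hconst 1) varX)
    (hconst varX) (constantCoeff_subst_binomialSeries (hconst 1) varX)

end GeneratingFunction

/-! ### From permutations to words -/

section Permutations

variable {k₁ k₂ n : ℕ}

theorem reduction_le_of_le {p : ℕ} {f : Fin p → ℕ} {a b : Fin p} (h : f a ≤ f b) :
    reduction f a ≤ reduction f b :=
  Finset.card_le_card fun c hc => by
    rw [Finset.mem_filter] at hc ⊢
    exact ⟨hc.1, hc.2.trans_le h⟩

theorem reduction_lt_iff {p : ℕ} {f : Fin p → ℕ} {a b : Fin p} :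
    reduction f a < reduction f b ↔ f a < f b := by
  constructor
  · intro h
    by_contra hcon
    exact (reduction_le_of_le (not_lt.1 hcon)).not_gt h
  · intro h
    refine Finset.card_lt_card ⟨fun c hc => ?_, fun hsub => ?_⟩
    · rw [Finset.mem_filter] at hc ⊢
      exact ⟨hc.1, hc.2.trans h⟩
    · have := hsub (Finset.mem_filter.2 ⟨Finset.mem_univ a, h⟩)
      exact (Finset.mem_filter.1 this).2.false

theorem reduction_lt {p : ℕ} (f : Fin p → ℕ) (a : Fin p) : reduction f a < p := by
  have : reduction f a < (Finset.univ : Finset (Fin p)).card := by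
    refine Finset.card_lt_card ⟨Finset.subset_univ _, fun hsub => ?_⟩
    have := hsub (Finset.mem_univ a)
    exact (Finset.mem_filter.1 this).2.false
  rwa [Finset.card_univ, Fintype.card_fin] at this

theorem reduction_injective {p : ℕ} {f : Fin p → ℕ} (hf : Function.Injective f) :
    Function.Injective (reduction f) := by
  intro a b hab
  by_contra hne
  rcases lt_or_gt_of_ne (hf.ne hne) with h | h
  · exact (reduction_lt_iff.2 h).ne hab
  · exact (reduction_lt_iff.2 h).ne hab.symm

/-- Reduction preserves order, so a match is a condition on inequalities. Given the two increasing
runs, ranks 0 and 1 at positions 0 and `k₁` amount to the two inequalities comparing position `k₁`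
with positions 0 and 1. -/
theorem hasMatchAt_iff (hk₁ : 2 ≤ k₁) (hk₂ : 2 ≤ k₂) (σ : Equiv.Perm (Fin n)) {w : ℕ → ℕ}
    (hw : ∀ (i : ℕ) (h : i < n), w i = σ ⟨i, h⟩) (s : ℕ) :
    HasMatchAt (gammaFamily k₁ k₂) σ s ↔ Occ k₁ k₂ w s n := by
  constructor
  · rintro ⟨j, -, hj, τ, ⟨hp, h0, h1, hl, hr⟩, hτ⟩
    have key : ∀ a b : ℕ, ∀ (ha : a < j + 1) (hb : b < j + 1), τ ⟨a, ha⟩ < τ ⟨b, hb⟩ →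
        w (s + a) < w (s + b) := by
      intro a b ha hb h
      rw [Fin.lt_def, ← hτ, ← hτ, reduction_lt_iff] at h
      rw [hw _ (by omega), hw _ (by omega)]
      exact h
    refine ⟨by omega, fun i hi => ?_, fun i hi hi' => ?_, ?_, ?_⟩
    · exact key i (i + 1) (by omega) (by omega) (hl _ _ (by simp [Fin.lt_def]) hi)
    · exact key i (i + 1) (by omega) (by omega) (hr _ _ hi (by simp [Fin.lt_def]))
    · have := key 0 k₁ (by omega) (by omega) (by
        rw [Fin.lt_def, h0 _ rfl, h1 _ rfl]; omega)
      simpa using this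
    -- The value of `τ` at position 1 is above 0 by the first run and differs from 1 by injectivity,
    -- so it exceeds the value 1 at position `k₁`.
    · refine key k₁ 1 (by omega) (by omega) ?_
      have h2 : τ ⟨0, by omega⟩ < τ ⟨1, by omega⟩ :=
        hl _ _ (by simp [Fin.lt_def]) (by change 1 < k₁; omega)
      have h3 : τ ⟨1, by omega⟩ ≠ τ ⟨k₁, by omega⟩ := τ.injective.ne (by simp; omega)
      rw [ne_eq, Fin.ext_iff] at h3
      rw [Fin.lt_def] at h2 ⊢
      rw [h1 ⟨k₁, by omega⟩ rfl] at h3 ⊢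
      rw [h0 ⟨0, by omega⟩ rfl] at h2
      omega
  · intro ho
    have hlen := ho.1
    obtain ⟨j, hj⟩ : ∃ j, k₁ + k₂ = j + 1 := ⟨k₁ + k₂ - 1, by omega⟩
    have hjn : s + j < n := by omega
    set f : Fin (j + 1) → ℕ := fun b => (σ ⟨s + b, by omega⟩ : ℕ) with hf
    have hfw : ∀ b : Fin (j + 1), f b = w (s + b) := fun b => (hw _ _).symm
    have hinj : Function.Injective f := by
      intro a b hab
      have h1 := σ.injective (Fin.ext hab)
      rw [Fin.ext_iff] at h1 ⊢
      simpa using h1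
    let g : Fin (j + 1) → Fin (j + 1) := fun a => ⟨reduction f a, reduction_lt f a⟩
    have hg : Function.Bijective g := Finite.injective_iff_bijective.1 fun a b hab =>
      reduction_injective hinj (Fin.ext_iff.1 hab)
    have hmono : ∀ a b : Fin (j + 1), w (s + a) < w (s + b) → g a < g b := by
      intro a b h
      rw [← hfw, ← hfw] at h
      exact reduction_lt_iff.2 h
    refine ⟨j, by omega, hjn, Equiv.ofBijective g hg, ⟨hj.symm, ?_, ?_, ?_, ?_⟩, fun a => rfl⟩
    · intro a ha
      change reduction f a = 0
      rw [reduction, Finset.card_eq_zero, Finset.filter_eq_empty_iff]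
      intro b _ hb
      rw [hfw, hfw, ha, add_zero] at hb
      rcases Nat.eq_zero_or_pos (b : ℕ) with h | h
      · rw [h, add_zero] at hb
        exact hb.false
      · exact hb.not_gt (ho.head_lt h (by omega))
    · intro a ha
      change reduction f a = 1
      rw [reduction, Finset.card_eq_one]
      -- Position 0 is the only one with a smaller entry than position `k₁`, which therefore has
      -- rank 1.
      refine ⟨0, ?_⟩
      ext b
      rw [Finset.mem_filter, Finset.mem_singleton, hfw, hfw, ha]
      constructor
      · rintro ⟨-, hb⟩
        by_contra hb0
        have hb1 : 1 ≤ (b : ℕ) := Nat.one_le_iff_ne_zero.2 fun h => hb0 (Fin.ext h)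
        rcases lt_trichotomy (b : ℕ) k₁ with h | h | h
        · exact hb.not_ge (ho.2.2.2.2.le.trans (ho.second_le hb1 h))
        · rw [h] at hb
          exact hb.false
        · exact hb.not_gt (ho.right_lt le_rfl h (by omega))
      · rintro rfl
        exact ⟨Finset.mem_univ _, ho.2.2.2.1⟩
    · intro a b hab hb
      exact hmono a b (ho.left_lt hab hb)
    · intro a b ha hab
      exact hmono a b (ho.right_lt ha hab (by omega))

theorem lrmin_eq_leftMinima (σ : Equiv.Perm (Fin n)) {w : ℕ → ℕ}
    (hw : ∀ (i : ℕ) (h : i < n), w i = σ ⟨i, h⟩) : lrmin σ = leftMinima w 0 n := by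
  classical
  rw [lrmin, leftMinima]
  refine Finset.card_bij (fun j _ => (j : ℕ)) ?_ ?_ ?_
  · intro j hj
    rw [Finset.mem_filter] at hj ⊢
    refine ⟨by simp, fun i _ hij => ?_⟩
    rw [hw j j.2, hw i (hij.trans j.2)]
    exact hj.2 ⟨i, hij.trans j.2⟩ hij
  · intro a _ b _ hab
    exact Fin.ext hab
  · intro j hj
    rw [Finset.mem_filter, Finset.mem_Ico] at hj
    refine ⟨⟨j, hj.1.2⟩, Finset.mem_filter.2 ⟨Finset.mem_univ _, fun i hi => ?_⟩, rfl⟩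
    have := hj.2 i (Nat.zero_le _) hi
    rwa [hw j hj.1.2, hw i i.2] at this

theorem des_eq_descents (σ : Equiv.Perm (Fin n)) {w : ℕ → ℕ}
    (hw : ∀ (i : ℕ) (h : i < n), w i = σ ⟨i, h⟩) : des σ = descents w 0 n := by
  classical
  rw [des, descents]
  refine Finset.card_bij (fun j _ => (j : ℕ)) ?_ ?_ ?_
  · intro j hj
    rw [Finset.mem_filter] at hj ⊢
    obtain ⟨-, h, hj⟩ := hj
    refine ⟨by rw [Finset.mem_Ico]; omega, ?_⟩
    rw [hw j j.2, hw (j + 1) h]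
    exact (Fin.lt_def.1 hj).not_gt
  · intro a _ b _ hab
    exact Fin.ext hab
  · intro j hj
    rw [Finset.mem_filter, Finset.mem_Ico] at hj
    obtain ⟨h1, h2⟩ := hj
    have hj : j < n := by omega
    have hj' : j + 1 < n := by omega
    refine ⟨⟨j, hj⟩, Finset.mem_filter.2 ⟨Finset.mem_univ _, hj', ?_⟩, rfl⟩
    rw [hw j hj, hw (j + 1) hj', ← Fin.lt_def, not_lt] at h2
    refine lt_of_le_of_ne h2 (σ.injective.ne ?_)
    simp

theorem nmPoly_eq_wordSum (hk₁ : 2 ≤ k₁) (hk₂ : 2 ≤ k₂) (n : ℕ) :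
    nmPoly (gammaFamily k₁ k₂) n = wordSum (avoidWt k₁ k₂ varX varY) n := by
  classical
  by_cases hn : n = 0
  · subst hn
    rw [nmPoly, if_pos rfl,
      wordSum_zero _ (fun _ => 0) (orderInvariant_avoidWt hk₁ hk₂ varX varY), avoidWt_nil le_rfl]
  rw [nmPoly, if_neg hn, noMatch, Finset.sum_filter, wordSum]
  refine Finset.sum_bij (fun σ _ => List.ofFn fun i => (σ i : ℕ)) ?_ ?_ ?_ ?_
  · intro σ _
    refine mem_arrangements.2 ⟨?_, ?_⟩
    · exact List.nodup_ofFn.2 (Fin.val_injective.comp σ.injective)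
    · ext a
      rw [List.mem_toFinset, List.mem_ofFn', Set.mem_range, Finset.mem_range]
      constructor
      · rintro ⟨i, rfl⟩
        exact (σ i).2
      · intro ha
        exact ⟨σ.symm ⟨a, ha⟩, by simp⟩
  · intro σ _ τ _ h
    have := List.ofFn_injective h
    exact Equiv.ext fun i => Fin.ext (congrFun this i)
  · intro l hl
    have hlen : l.length = n := by rw [length_of_mem_arrangements hl, Finset.card_range]
    subst hlen
    have hlt : ∀ i : Fin l.length, l[i] < l.length := fun i =>
      Finset.mem_range.1 ((mem_iff_of_mem_arrangements hl).1 (List.getElem_mem i.2))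
    have hinj : Function.Injective fun i : Fin l.length => (⟨l[i], hlt i⟩ : Fin l.length) := by
      intro i j hij
      exact Fin.ext (((mem_arrangements.1 hl).1.getElem_inj_iff).1 (Fin.ext_iff.1 hij))
    refine ⟨Equiv.ofBijective _ (Finite.injective_iff_bijective.1 hinj), Finset.mem_univ _, ?_⟩
    exact List.ofFn_getElem
  · intro σ _
    have hw : ∀ (i : ℕ) (h : i < n),
        (List.ofFn fun i => (σ i : ℕ)).getD i 0 = σ ⟨i, h⟩ := by
      intro i h
      simp [List.getD, h]
    have hav : (∀ i, ¬ HasMatchAt (gammaFamily k₁ k₂) σ i) ↔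
        Avoids k₁ k₂ (fun i => (List.ofFn fun i => (σ i : ℕ)).getD i 0) 0 n := by
      refine forall_congr' fun i => ?_
      rw [hasMatchAt_iff hk₁ hk₂ σ hw]
      simp
    rw [onList, avoidWt, List.length_ofFn, if_neg (show ¬ n ≤ 0 by omega), ← lrmin_eq_leftMinima σ hw,
      ← des_eq_descents σ hw]
    by_cases h : ∀ i, ¬ HasMatchAt (gammaFamily k₁ k₂) σ i
    · rw [if_pos h, if_pos (hav.1 h)]
    · rw [if_neg h, if_neg (mt hav.2 h)]

end Permutations

theorem theorem3 (k₁ k₂ : ℕ) (hk₁ : 2 ≤ k₁) (hk₂ : 2 ≤ k₂) :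
    ∃ U : ℕ → Polynomial ℤ,
      NM (gammaFamily k₁ k₂) = formalPow (recip (expGen fun n => inY (U n))) varX ∧
      U 0 = 1 ∧
      U 1 = -Polynomial.X ∧
      (∀ n : ℕ, 2 ≤ n → ¬ (k₁ < k₂ ∧ n = k₂) →
        U n = (1 - Polynomial.X) * U (n - 1) -
          Polynomial.X * (Nat.choose (n - 2) (k₁ - 1) : Polynomial ℤ) *
            (back U n (max k₁ k₂) +
              Polynomial.X * ∑ i ∈ Finset.Icc 1 (min k₁ k₂ - 1), back U n (max k₁ k₂ + i))) ∧
      (k₁ < k₂ → U k₂ = (1 - Polynomial.X) * U (k₂ - 1)) := by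
  refine ⟨wordSum (clusterWt k₁ k₂ Polynomial.X), ?_, wordSum_clusterWt_zero hk₁ hk₂ _,
    wordSum_clusterWt_one _, fun n hn hne => clusterPolynomial_recursion hk₁ hk₂ rfl hn hne,
    fun _ => wordSum_clusterWt_of_lt hk₁ hk₂ _ hk₂ (by omega)⟩
  rw [← expGen_avoidWt_eq_formalPow hk₁ hk₂, NM]
  congr 1
  exact funext (nmPoly_eq_wordSum hk₁ hk₂)
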